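/- **Setting.** A dcpo is a poset in which every directed family has a supremum; it carries its Scott topology. Let $\mathbf{IR}_\bot$ be the pointed dcpo of compact intervals $[a,b]$ ($a\le b$ real), ordered by reverse inclusion, with a least element $\bot$ added; $i(x)=[x,x]$ embeds $\mathbb R$. A continuous valuation on a space $X$ is a strict, modular, Scott-continuous map from the open sets of $X$ to $[0,\infty]$; the minimal valuations on a dcpo $X$, $\mathbf V_m X$, are the elements of the smallest set of continuous valuations that contains the finite combinations $\sum_k r_k\delta_{x_k}$ ($r_k\in[0,\infty)$) and is closed under directed suprema. ISPCF is the simply typed call-by-name language with types $\mathtt{unit},\mathtt{void},\mathtt{int},\mathtt{real},\sigma+\tau,\sigma\times\tau,\sigma\to\tau,D\tau$, with typed variables, constants (including $\underline *$ and every integer), $\lambda$-abstraction, application, fixed points, pairing and projections, injections and case, $\mathtt{sample}[\mu]$ ($\mu$ in a fixed set of measures on $\mathbb R$), $\mathtt{score}$, $\mathtt{ret}$ and $\mathtt{do}\,\{x\leftarrow M\};N$. Its denotational semantics is in dcpos: $[\![\mathtt{unit}]\!]=\{\bot<*\}$, $[\![\mathtt{void}]\!]=\{\bot\}$, $[\![\mathtt{int}]\!]=\mathbb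 Z_\bot$ (flat), $[\![\mathtt{real}]\!]=\mathbf{IR}_\bot$, $[\![\sigma+\tau]\!]=([\![\sigma]\!]+[\![\tau]\!])_\bot$, $[\![\sigma\times\tau]\!]$ the product, $[\![\sigma\to\tau]\!]$ the dcpo of Scott-continuous maps, $[\![D\tau]\!]=\mathbf V_m[\![\tau]\!]$; $[\![\mathtt{sample}[\mu]]\!]\rho=i[\mu]$ (image valuation), $[\![\mathtt{ret}\,M]\!]\rho=\delta_{[\![M]\!]\rho}$, and $[\![\mathtt{do}\,\{x\leftarrow M\};N]\!]\rho(V)=\int [\![N]\!](\rho[x\mapsto v])(V)\,d([\![M]\!]\rho)(v)$ for every Scott-open $V$; the other constructs have their usual interpretation. Let $\lambda_1$ be the uniform probability measure on $[0,1]$, seen as a measure on $\mathbb R$, let $\lambda_1^\infty$ be the product on $\mathbb R^{\mathbb N}$ of countably many copies of $\lambda_1$, and let $j:\mathbb R^{\mathbb N}\to[\![\mathtt{int}\to\mathtt{real}]\!]$ be the continuous map with $j(\vec x)(n)=i(x_n)$ for $n\in\mathbb N$ and $j(\vec x)(n)=\bot$ if $n<0$ or $n=\bot$. Let $\mathrm{num}(s)=\sum_{k}s_k/2^{k+1}$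 for $s\in\{0,1\}^{\mathbb N}$, and let $\mathrm{num}':\{0,1\}_\bot^{\mathbb N}\to\mathbf{IR}_\bot$ be any Scott-continuous map with $\mathrm{num}'(s)=i(\mathrm{num}(s))$ for all $s\in\{0,1\}^{\mathbb N}$. Let $\mathrm{bin}':\mathbf{IR}_\bot\to\{0,1\}_\bot^{\mathbb N}$ be the partial binary expansion: $\mathrm{bin}'(\bot)_k=\bot$; $\mathrm{bin}'([a,b])_0$ is $0$ if $b<1/2$, $1$ if $a>1/2$, and $\bot$ otherwise; $\mathrm{bin}'([a,b])_{k+1}=\mathrm{bin}'(\mathbf c)_k$ where $\mathbf c$ is $[2a,2b]$ if $b<1/2$, $[2a-1,2b-1]$ if $a>1/2$, and $\bot$ otherwise. Let $\langle\cdot,\cdot\rangle:\mathbb N\times\mathbb N\to\mathbb N$ be any bijection (for example the one that interleaves binary digits), and for a sequence $s$ let $s[m]=(s_{\langle m,n\rangle})_{n\in\mathbb N}$. **Theorem.** Assume that one may sample from $\lambda_1$, and that ISPCF has a constant $\mathtt{mux}:\mathtt{real}\to\mathtt{int}\to\mathtt{real}$ whose semantics $\mathrm{mux}$ satisfies, for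 every $x\in\mathbb R$, $\mathrm{mux}(i(x))(m)=\mathrm{num}'(\mathrm{bin}'(i(x))[m])$ for every $m\in\mathbb N$, and $\mathrm{mux}(i(x))(n)=\bot$ if $n$ is a negative integer or $n=\bot$. Let $$\mathtt{rand\_uniform\_seq}=\mathtt{do}\,\{r\leftarrow\mathtt{sample}[\lambda_1]\};\ \mathtt{ret}\,(\mathtt{mux}\;r),$$ a term of type $D(\mathtt{int}\to\mathtt{real})$. Then for every environment $\rho$, $$[\![\mathtt{rand\_uniform\_seq}]\!]\rho=j[\lambda_1^\infty],$$ the image valuation under $j$ of the restriction of $\lambda_1^\infty$ to the open sets of $\mathbb R^{\mathbb N}$. -/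

import Mathlib

open MeasureTheory Set TopologicalSpace
open Topology (WithScott)
open scoped ENNReal NNReal

namespace ISPCF

/-! ### Dcpos -/

/-- A dcpo: a partial order in which every (non-empty) directed family has a supremum. -/
class IsDcpo (α : Type*) [PartialOrder α] : Prop where
  exists_isLUB : ∀ D : Set α, D.Nonempty → DirectedOn (· ≤ ·) D → ∃ a, IsLUB D a

/-- The dcpo `[X → Y]` of Scott-continuous maps, ordered pointwise. -/
abbrev ScottHom (X Y : Type*) [PartialOrder X] [PartialOrder Y] : Type _ :=
  {f : X → Y // ScottContinuous f}

/-- A set ordered by equality. -/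
@[ext] structure Flat (α : Type*) where
  /-- The underlying element. -/
  val : α

instance (α : Type*) : PartialOrder (Flat α) where
  le a b := a = b
  le_refl _ := rfl
  le_trans _ _ _ h h' := h.trans h'
  le_antisymm _ _ h _ := h

section Order

variable {X Y Z ι : Type*} [PartialOrder X] [PartialOrder Y] [PartialOrder Z]

theorem isLUB_image_iff_range {X Y : Type*} [PartialOrder Y] {D : Set X} {f : X → Y} {y : Y} :
    IsLUB (f '' D) y ↔ IsLUB (range fun d : D => f d) y := by
  rw [image_eq_range]

theorem directedOn_image_mono {D : Set X} (hd : DirectedOn (· ≤ ·) D) {f : X → Y}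
    (hf : Monotone f) : DirectedOn (· ≤ ·) (f '' D) := by
  rintro _ ⟨a, ha, rfl⟩ _ ⟨b, hb, rfl⟩
  obtain ⟨c, hc, hac, hbc⟩ := hd a ha b hb
  exact ⟨f c, ⟨c, hc, rfl⟩, hf hac, hf hbc⟩

/-- A pointwise supremum of Scott-continuous maps is Scott-continuous. -/
theorem scott_of_isLUB {F : ι → X → Y} {G : X → Y} (hF : ∀ i, ScottContinuous (F i))
    (hG : ∀ x, IsLUB (range fun i => F i x) (G x)) : ScottContinuous G := by
  intro d hne hd a ha
  constructor
  · rintro _ ⟨x, hx, rfl⟩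
    refine (hG x).2 ?_
    rintro _ ⟨i, rfl⟩
    exact ((hF i).monotone (ha.1 hx)).trans ((hG a).1 ⟨i, rfl⟩)
  · intro b hb
    refine (hG a).2 ?_
    rintro _ ⟨i, rfl⟩
    refine (hF i hne hd ha).2 ?_
    rintro _ ⟨x, hx, rfl⟩
    exact ((hG x).1 ⟨i, rfl⟩).trans (hb ⟨x, hx, rfl⟩)

/-- If the image of a directed set has pointwise suprema, then it has a supremum in `[X → Y]`. -/
theorem ScottHom.isLUB_of_pointwise {D : Set (ScottHom X Y)} {f : ScottHom X Y}
    (h : ∀ x, IsLUB ((fun g : ScottHom X Y => g.1 x) '' D) (f.1 x)) : IsLUB D f :=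
  ⟨fun g hg x => (h x).1 ⟨g, hg, rfl⟩, fun g hg x => (h x).2 (by
    rintro _ ⟨k, hk, rfl⟩
    exact hg hk x)⟩

theorem ScottHom.exists_isLUB [IsDcpo Y] {D : Set (ScottHom X Y)} (hne : D.Nonempty)
    (hd : DirectedOn (· ≤ ·) D) :
    ∃ f : ScottHom X Y, ∀ x, IsLUB ((fun g : ScottHom X Y => g.1 x) '' D) (f.1 x) := by
  have h : ∀ x, ∃ y, IsLUB ((fun g : ScottHom X Y => g.1 x) '' D) y := fun x =>
    IsDcpo.exists_isLUB _ (hne.image _) (directedOn_image_mono hd fun _ _ h => h x)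
  choose F hF using h
  refine ⟨⟨F, scott_of_isLUB (F := fun g : D => g.1.1) (fun g => g.1.2) fun x => ?_⟩, hF⟩
  exact isLUB_image_iff_range.1 (hF x)

theorem ScottHom.isLUB_apply [IsDcpo Y] {D : Set (ScottHom X Y)} (hne : D.Nonempty)
    (hd : DirectedOn (· ≤ ·) D) {f : ScottHom X Y} (hf : IsLUB D f) (x : X) :
    IsLUB ((fun g : ScottHom X Y => g.1 x) '' D) (f.1 x) := by
  obtain ⟨g, hg⟩ := ScottHom.exists_isLUB hne hd
  rw [hf.unique (ScottHom.isLUB_of_pointwise hg)]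
  exact hg x

instance [IsDcpo Y] : IsDcpo (ScottHom X Y) where
  exists_isLUB D hne hd := by
    obtain ⟨f, hf⟩ := ScottHom.exists_isLUB hne hd
    exact ⟨f, ScottHom.isLUB_of_pointwise hf⟩

instance [OrderBot Y] : OrderBot (ScottHom X Y) where
  bot := ⟨fun _ => ⊥, ScottContinuous.const _⟩
  bot_le _ _ := bot_le

theorem ScottHom.scott_apply [IsDcpo Y] (x : X) :
    ScottContinuous fun f : ScottHom X Y => f.1 x :=
  fun _ hne hd _ hf => ScottHom.isLUB_apply hne hd hf x

theorem ScottHom.scott_mk {F : X → ScottHom Y Z} (hF : ∀ y, ScottContinuous fun x => (F x).1 y) :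
    ScottContinuous F := by
  intro d hne hd a ha
  refine ScottHom.isLUB_of_pointwise fun y => ?_
  rw [image_image]
  exact hF y hne hd ha

theorem scott_pi {π : ι → Type*} [∀ i, PartialOrder (π i)] {F : X → ∀ i, π i}
    (hF : ∀ i, ScottContinuous fun x => F x i) : ScottContinuous F := by
  intro d hne hd a ha
  refine isLUB_pi.2 fun i => ?_
  rw [image_image]
  exact hF i hne hd ha

theorem scott_eval {π : ι → Type*} [∀ i, PartialOrder (π i)] (i : ι) :
    ScottContinuous fun f : ∀ i, π i => f i :=
  fun _ _ _ _ hf => isLUB_pi.1 hf i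

/-- A map of two arguments that is Scott-continuous in each of them may be composed with two
Scott-continuous maps. -/
theorem scott_comp₂ {W : Type*} [PartialOrder W] {g : X → Y → Z}
    (h₁ : ∀ y, ScottContinuous fun x => g x y) (h₂ : ∀ x, ScottContinuous fun y => g x y)
    {a : W → X} {b : W → Y} (ha : ScottContinuous a) (hb : ScottContinuous b) :
    ScottContinuous fun w => g (a w) (b w) :=
  ScottContinuous.comp (g := fun p : X × Y => g p.1 p.2) (ScottContinuous.prodMk ha hb)
    (ScottContinuous.fromProd (f := fun p : X × Y => g p.1 p.2) h₂ h₁)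

instance [IsDcpo X] [IsDcpo Y] : IsDcpo (X × Y) where
  exists_isLUB D hne hd := by
    obtain ⟨x, hx⟩ := IsDcpo.exists_isLUB _ (hne.image Prod.fst)
      (directedOn_image_mono hd monotone_fst)
    obtain ⟨y, hy⟩ := IsDcpo.exists_isLUB _ (hne.image Prod.snd)
      (directedOn_image_mono hd monotone_snd)
    exact ⟨(x, y), isLUB_prod.2 ⟨hx, hy⟩⟩

theorem isLUB_sum_inl {D : Set (X ⊕ Y)} (hd : DirectedOn (· ≤ ·) D)
    {a : X} (ha : Sum.inl a ∈ D) : D = Sum.inl '' (Sum.inl ⁻¹' D) := by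
  ext s
  constructor
  · intro hs
    obtain ⟨u, hu, h1, h2⟩ := hd _ ha s hs
    cases s with
    | inl x => exact ⟨x, hs, rfl⟩
    | inr y =>
      cases u with
      | inl u => simp at h2
      | inr u => simp at h1
  · rintro ⟨x, hx, rfl⟩
    exact hx

theorem isLUB_sum_inr {D : Set (X ⊕ Y)} (hd : DirectedOn (· ≤ ·) D)
    {a : Y} (ha : Sum.inr a ∈ D) : D = Sum.inr '' (Sum.inr ⁻¹' D) := by
  ext s
  constructor
  · intro hs
    obtain ⟨u, hu, h1, h2⟩ := hd _ ha s hs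
    cases s with
    | inr x => exact ⟨x, hs, rfl⟩
    | inl y =>
      cases u with
      | inl u => simp at h1
      | inr u => simp at h2
  · rintro ⟨x, hx, rfl⟩
    exact hx

theorem scott_inl : ScottContinuous (Sum.inl : X → X ⊕ Y) := by
  intro d hne hd a ha
  constructor
  · rintro _ ⟨x, hx, rfl⟩
    exact Sum.inl_le_inl_iff.2 (ha.1 hx)
  · intro b hb
    obtain ⟨x, hx⟩ := hne
    cases b with
    | inl b => exact Sum.inl_le_inl_iff.2 (ha.2 fun y hy => Sum.inl_le_inl_iff.1 (hb ⟨y, hy, rfl⟩))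
    | inr b => simpa using hb ⟨x, hx, rfl⟩

theorem scott_inr : ScottContinuous (Sum.inr : Y → X ⊕ Y) := by
  intro d hne hd a ha
  constructor
  · rintro _ ⟨x, hx, rfl⟩
    exact Sum.inr_le_inr_iff.2 (ha.1 hx)
  · intro b hb
    obtain ⟨x, hx⟩ := hne
    cases b with
    | inr b => exact Sum.inr_le_inr_iff.2 (ha.2 fun y hy => Sum.inr_le_inr_iff.1 (hb ⟨y, hy, rfl⟩))
    | inl b => simpa using hb ⟨x, hx, rfl⟩

theorem directedOn_preimage {D : Set Y} (hd : DirectedOn (· ≤ ·) D) {f : X → Y}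
    (hf : ∀ a b, f a ≤ f b ↔ a ≤ b) (hD : ∀ y ∈ D, ∀ x, f x ≤ y → y ∈ range f) :
    DirectedOn (· ≤ ·) (f ⁻¹' D) := by
  intro a ha b hb
  obtain ⟨c, hc, h1, h2⟩ := hd _ ha _ hb
  obtain ⟨c, rfl⟩ := hD c hc a h1
  exact ⟨c, hc, (hf _ _).1 h1, (hf _ _).1 h2⟩

theorem directedOn_inl {D : Set (X ⊕ Y)} (hd : DirectedOn (· ≤ ·) D) :
    DirectedOn (· ≤ ·) (Sum.inl ⁻¹' D : Set X) :=
  directedOn_preimage hd (fun _ _ => Sum.inl_le_inl_iff) fun y _ x h => by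
    cases y <;> simp_all

theorem directedOn_inr {D : Set (X ⊕ Y)} (hd : DirectedOn (· ≤ ·) D) :
    DirectedOn (· ≤ ·) (Sum.inr ⁻¹' D : Set Y) :=
  directedOn_preimage hd (fun _ _ => Sum.inr_le_inr_iff) fun y _ x h => by
    cases y <;> simp_all

instance [IsDcpo X] [IsDcpo Y] : IsDcpo (X ⊕ Y) where
  exists_isLUB D hne hd := by
    obtain ⟨s, hs⟩ := id hne
    cases s with
    | inl x =>
      obtain ⟨a, ha⟩ := IsDcpo.exists_isLUB _ ⟨x, hs⟩ (directedOn_inl hd)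
      rw [isLUB_sum_inl hd hs]
      exact ⟨_, scott_inl ⟨x, hs⟩ (directedOn_inl hd) ha⟩
    | inr x =>
      obtain ⟨a, ha⟩ := IsDcpo.exists_isLUB _ ⟨x, hs⟩ (directedOn_inr hd)
      rw [isLUB_sum_inr hd hs]
      exact ⟨_, scott_inr ⟨x, hs⟩ (directedOn_inr hd) ha⟩

theorem scott_sumElim {f : X → Z} {g : Y → Z} (hf : ScottContinuous f) (hg : ScottContinuous g) :
    ScottContinuous (Sum.elim f g) := by
  intro D hne hd s hs
  obtain ⟨t, ht⟩ := id hne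
  cases t with
  | inl x =>
    have hD := isLUB_sum_inl hd ht
    cases s with
    | inr y => simpa using hs.1 ht
    | inl a =>
      have ha : IsLUB (Sum.inl ⁻¹' D) a :=
        ⟨fun b hb => Sum.inl_le_inl_iff.1 (hs.1 hb), fun b hb =>
          Sum.inl_le_inl_iff.1 (hs.2 (by
            rw [hD]; rintro _ ⟨c, hc, rfl⟩; exact Sum.inl_le_inl_iff.2 (hb hc)))⟩
      have := hf ⟨x, ht⟩ (directedOn_inl hd) ha
      rw [hD, image_image]
      exact this
  | inr x =>
    have hD := isLUB_sum_inr hd ht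
    cases s with
    | inl y => simpa using hs.1 ht
    | inr a =>
      have ha : IsLUB (Sum.inr ⁻¹' D) a :=
        ⟨fun b hb => Sum.inr_le_inr_iff.1 (hs.1 hb), fun b hb =>
          Sum.inr_le_inr_iff.1 (hs.2 (by
            rw [hD]; rintro _ ⟨c, hc, rfl⟩; exact Sum.inr_le_inr_iff.2 (hb hc)))⟩
      have := hg ⟨x, ht⟩ (directedOn_inr hd) ha
      rw [hD, image_image]
      exact this

theorem scott_coe : ScottContinuous ((↑) : X → WithBot X) := by
  intro d hne hd a ha
  constructor
  · rintro _ ⟨x, hx, rfl⟩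
    exact WithBot.coe_le_coe.2 (ha.1 hx)
  · intro b hb
    obtain ⟨x, hx⟩ := hne
    induction b with
    | bot => simpa using hb ⟨x, hx, rfl⟩
    | coe b => exact WithBot.coe_le_coe.2 (ha.2 fun y hy => WithBot.coe_le_coe.1 (hb ⟨y, hy, rfl⟩))

theorem directedOn_coe {D : Set (WithBot X)} (hd : DirectedOn (· ≤ ·) D) :
    DirectedOn (· ≤ ·) ((↑) ⁻¹' D : Set X) :=
  directedOn_preimage hd (fun _ _ => WithBot.coe_le_coe) fun y _ x h => by
    induction y with
    | bot => simp at h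
    | coe y => exact ⟨y, rfl⟩

theorem isLUB_withBot {D : Set (WithBot X)} {s : WithBot X} :
    IsLUB D s ↔ IsLUB ((↑) '' ((↑) ⁻¹' D : Set X) : Set (WithBot X)) s := by
  have : upperBounds D = upperBounds ((↑) '' ((↑) ⁻¹' D : Set X) : Set (WithBot X)) := by
    ext u
    constructor
    · rintro h _ ⟨x, hx, rfl⟩
      exact h hx
    · intro h y hy
      induction y with
      | bot => exact bot_le
      | coe y => exact h ⟨y, hy, rfl⟩
  unfold IsLUB
  rw [this]

instance [IsDcpo X] : IsDcpo (WithBot X) where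
  exists_isLUB D hne hd := by
    rcases ((↑) ⁻¹' D : Set X).eq_empty_or_nonempty with h | h
    · refine ⟨⊥, isLUB_withBot.2 ?_⟩
      rw [h, image_empty]
      exact isLUB_empty
    · obtain ⟨a, ha⟩ := IsDcpo.exists_isLUB _ h (directedOn_coe hd)
      exact ⟨a, isLUB_withBot.2 (scott_coe h (directedOn_coe hd) ha)⟩

/-- The strict extension to the lift of a map. -/
def strictExt [OrderBot Y] (f : X → Y) : WithBot X → Y
  | ⊥ => ⊥
  | (x : X) => f x

theorem scott_strictExt [OrderBot Y] {f : X → Y} (hf : ScottContinuous f) :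
    ScottContinuous (strictExt f) := by
  intro D hne hd s hs
  rcases ((↑) ⁻¹' D : Set X).eq_empty_or_nonempty with h | h
  · have hD : D = {⊥} := by
      refine hne.subset_singleton_iff.1 fun y hy => ?_
      induction y with
      | bot => rfl
      | coe y => exact absurd (show y ∈ ((↑) ⁻¹' D : Set X) from hy) (h ▸ notMem_empty y)
    subst hD
    rw [isLUB_singleton.unique hs |>.symm, image_singleton]
    exact isLUB_singleton
  · induction s with
    | bot =>
      obtain ⟨x, hx⟩ := h
      simpa using hs.1 hx
    | coe a =>
      have ha : IsLUB ((↑) ⁻¹' D : Set X) a :=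
        ⟨fun b hb => WithBot.coe_le_coe.1 (hs.1 hb), fun b hb =>
          WithBot.coe_le_coe.1 ((isLUB_withBot.1 hs).2 (by
            rintro _ ⟨c, hc, rfl⟩; exact WithBot.coe_le_coe.2 (hb hc)))⟩
      have key := hf h (directedOn_coe hd) ha
      constructor
      · rintro _ ⟨y, hy, rfl⟩
        induction y with
        | bot => exact bot_le
        | coe y => exact key.1 ⟨y, hy, rfl⟩
      · intro b hb
        refine key.2 ?_
        rintro _ ⟨y, hy, rfl⟩
        exact hb ⟨_, hy, rfl⟩

theorem flat_isLUB {α : Type*} {D : Set (Flat α)} (hne : D.Nonempty)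
    (hd : DirectedOn (· ≤ ·) D) : ∃ a, D = {a} := by
  obtain ⟨a, ha⟩ := hne
  refine ⟨a, eq_singleton_iff_unique_mem.2 ⟨ha, fun b hb => ?_⟩⟩
  obtain ⟨c, -, h1, h2⟩ := hd a ha b hb
  exact (show b = c from h2).trans (show a = c from h1).symm

instance {α : Type*} : IsDcpo (Flat α) where
  exists_isLUB D hne hd := by
    obtain ⟨a, rfl⟩ := flat_isLUB hne hd
    exact ⟨a, isLUB_singleton⟩

instance : IsDcpo PUnit where
  exists_isLUB _ _ _ := ⟨PUnit.unit, fun _ _ => le_rfl, fun _ _ => le_rfl⟩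

theorem scott_flat {α : Type*} (f : Flat α → X) : ScottContinuous f := by
  intro D hne hd s hs
  obtain ⟨a, rfl⟩ := flat_isLUB hne hd
  rw [isLUB_singleton.unique hs |>.symm, image_singleton]
  exact isLUB_singleton

/-- The iterates `fⁿ ⊥` of a Scott-continuous map on a pointed poset. -/
def iter [OrderBot X] (f : ScottHom X X) : ℕ → X
  | 0 => ⊥
  | n + 1 => f.1 (iter f n)

theorem iter_mono [OrderBot X] (f : ScottHom X X) : Monotone (iter f) := by
  refine monotone_nat_of_le_succ fun n => ?_
  induction n with
  | zero => exact bot_le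
  | succ n ih => exact f.2.monotone ih

theorem exists_lfp [OrderBot X] [IsDcpo X] (f : ScottHom X X) : ∃ a, IsLUB (range (iter f)) a :=
  IsDcpo.exists_isLUB _ (range_nonempty _) (iter_mono f).directed_le.directedOn_range

/-- The least fixed point `sup_n fⁿ ⊥` of a Scott-continuous map on a pointed dcpo. -/
noncomputable def lfp [OrderBot X] [IsDcpo X] (f : ScottHom X X) : X := (exists_lfp f).choose

theorem isLUB_lfp [OrderBot X] [IsDcpo X] (f : ScottHom X X) : IsLUB (range (iter f)) (lfp f) :=
  (exists_lfp f).choose_spec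

theorem scott_lfp [OrderBot X] [IsDcpo X] : ScottContinuous (lfp : ScottHom X X → X) := by
  refine scott_of_isLUB (F := fun n f => iter f n) (fun n => ?_) fun f => isLUB_lfp f
  induction n with
  | zero => exact ScottContinuous.const _
  | succ n ih =>
    exact scott_comp₂ (g := fun (f : ScottHom X X) x => f.1 x) (fun x => ScottHom.scott_apply x)
      (fun f => f.2) ScottContinuous.id ih

end Order

/-! ### Continuous valuations -/

/-- A continuous valuation on a topological space: a strict, modular, Scott-continuous map from the
lattice of open sets to the extended non-negative reals. -/
structure ContVal (X : Type*) [TopologicalSpace X] where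
  /-- The mass of an open set. -/
  toFun : Opens X → ℝ≥0∞
  map_bot : toFun ⊥ = 0
  modular : ∀ U V, toFun (U ⊔ V) + toFun (U ⊓ V) = toFun U + toFun V
  scott : ScottContinuous toFun

theorem scott_add : ScottContinuous fun p : ℝ≥0∞ × ℝ≥0∞ => p.1 + p.2 := by
  have h : ∀ a : ℝ≥0∞, ScottContinuous fun b : ℝ≥0∞ => a + b := fun a =>
    ScottContinuous.of_map_sSup fun d hne _ => by
      rw [ENNReal.add_sSup hne, sSup_image]
  exact ScottContinuous.fromProd h fun b => by simpa only [add_comm] using h b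

theorem scott_mul (c : ℝ≥0∞) : ScottContinuous fun b : ℝ≥0∞ => c * b :=
  ScottContinuous.of_map_sSup fun d _ _ => by rw [ENNReal.mul_sSup, sSup_image]

theorem scott_sum {W ι : Type*} [PartialOrder W] (s : Finset ι) {f : ι → W → ℝ≥0∞}
    (hf : ∀ i, ScottContinuous (f i)) : ScottContinuous fun w => ∑ i ∈ s, f i w := by
  classical
  induction s using Finset.induction_on with
  | empty => simp
  | insert i s hi ih =>
    simp only [Finset.sum_insert hi]
    exact ScottContinuous.comp (ScottContinuous.prodMk (hf i) ih) scott_add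

namespace ContVal

variable {X Y : Type*} [TopologicalSpace X] [TopologicalSpace Y]

theorem ext' {μ ν : ContVal X} (h : ∀ U, μ.toFun U = ν.toFun U) : μ = ν := by
  cases μ; cases ν
  simpa using funext h

/-- The stochastic ordering. -/
instance : PartialOrder (ContVal X) where
  le μ ν := ∀ U, μ.toFun U ≤ ν.toFun U
  le_refl _ _ := le_rfl
  le_trans _ _ _ h h' U := (h U).trans (h' U)
  le_antisymm _ _ h h' := ext' fun U => le_antisymm (h U) (h' U)

/-- The Dirac valuation. -/
noncomputable def dirac (x : X) : ContVal X where
  toFun U := (U : Set X).indicator 1 x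
  map_bot := by simp
  modular U V := by
    by_cases h₁ : x ∈ U <;> by_cases h₂ : x ∈ V <;> simp [indicator, h₁, h₂]
  scott := by
    intro d hne hd U hU
    have hmono : Monotone fun U : Opens X => (U : Set X).indicator (1 : X → ℝ≥0∞) x :=
      fun U V h => indicator_le_indicator_of_subset h (fun _ => zero_le_one) x
    constructor
    · rintro _ ⟨V, hV, rfl⟩
      exact hmono (hU.1 hV)
    · intro b hb
      by_cases hx : x ∈ U
      · have hx' : x ∈ sSup d := hU.unique (isLUB_sSup d) ▸ hx
        obtain ⟨V, hV, hx'⟩ := Opens.mem_sSup.1 hx'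
        refine le_trans ?_ (hb ⟨V, hV, rfl⟩)
        simp [indicator, hx, hx']
      · simp [indicator, hx]

/-- The sum of two continuous valuations. -/
noncomputable def add (μ ν : ContVal X) : ContVal X where
  toFun U := μ.toFun U + ν.toFun U
  map_bot := by rw [μ.map_bot, ν.map_bot, add_zero]
  modular U V := by
    rw [add_add_add_comm, μ.modular, ν.modular, add_add_add_comm]
  scott := ScottContinuous.comp (ScottContinuous.prodMk μ.scott ν.scott) scott_add

/-- A scalar multiple of a continuous valuation. -/
noncomputable def smul (c : ℝ≥0∞) (ν : ContVal X) : ContVal X where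
  toFun U := c * ν.toFun U
  map_bot := by rw [ν.map_bot, mul_zero]
  modular U V := by rw [← mul_add, ν.modular, mul_add]
  scott := ScottContinuous.comp ν.scott (scott_mul c)

/-- The image of a continuous valuation under a continuous map. -/
def map (f : C(X, Y)) (ν : ContVal X) : ContVal Y where
  toFun U := ν.toFun (Opens.comap f U)
  map_bot := by
    rw [show Opens.comap f ⊥ = ⊥ from by ext; simp]
    exact ν.map_bot
  modular U V := by
    have h₁ : Opens.comap f (U ⊔ V) = Opens.comap f U ⊔ Opens.comap f V := by ext; simp
    have h₂ : Opens.comap f (U ⊓ V) = Opens.comap f U ⊓ Opens.comap f V := by ext; simp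
    rw [h₁, h₂]
    exact ν.modular _ _
  scott := by
    refine ScottContinuous.comp (ScottContinuous.of_map_sSup fun d hne hd => ?_) ν.scott
    ext x
    simp

theorem isLUB_of_pointwise {D : Set (ContVal X)} {ν : ContVal X}
    (h : ∀ U, IsLUB ((fun μ : ContVal X => μ.toFun U) '' D) (ν.toFun U)) : IsLUB D ν :=
  ⟨fun μ hμ U => (h U).1 ⟨μ, hμ, rfl⟩, fun μ hμ U => (h U).2 (by
    rintro _ ⟨κ, hκ, rfl⟩
    exact hμ hκ U)⟩

theorem exists_isLUB {D : Set (ContVal X)} (hne : D.Nonempty) (hd : DirectedOn (· ≤ ·) D) :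
    ∃ ν : ContVal X, ∀ U, IsLUB ((fun μ : ContVal X => μ.toFun U) '' D) (ν.toFun U) := by
  have : Nonempty D := hne.to_subtype
  have hlub : ∀ U, IsLUB (range fun μ : D => μ.1.toFun U) (⨆ μ : D, μ.1.toFun U) :=
    fun U => isLUB_iSup
  refine ⟨⟨fun U => ⨆ μ : D, μ.1.toFun U, ?_, fun U V => ?_, scott_of_isLUB
    (fun μ : D => μ.1.scott) hlub⟩, fun U => isLUB_image_iff_range.2 (hlub U)⟩
  · simp [map_bot]
  · have key : ∀ U V : Opens X, (⨆ μ : D, μ.1.toFun U) + (⨆ μ : D, μ.1.toFun V)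
        = ⨆ μ : D, (μ.1.toFun U + μ.1.toFun V) := fun U V =>
      ENNReal.iSup_add_iSup fun μ ν => by
        obtain ⟨κ, hκ, h1, h2⟩ := hd μ.1 μ.2 ν.1 ν.2
        exact ⟨⟨κ, hκ⟩, add_le_add (h1 U) (h2 V)⟩
    rw [key, key]
    exact iSup_congr fun μ => μ.1.modular U V

theorem isLUB_apply {D : Set (ContVal X)} (hne : D.Nonempty) (hd : DirectedOn (· ≤ ·) D)
    {ν : ContVal X} (hν : IsLUB D ν) (U : Opens X) :
    IsLUB ((fun μ : ContVal X => μ.toFun U) '' D) (ν.toFun U) := by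
  obtain ⟨κ, hκ⟩ := exists_isLUB hne hd
  rw [hν.unique (isLUB_of_pointwise hκ)]
  exact hκ U

instance : IsDcpo (ContVal X) where
  exists_isLUB D hne hd := by
    obtain ⟨ν, hν⟩ := exists_isLUB hne hd
    exact ⟨ν, isLUB_of_pointwise hν⟩

theorem scott_mk {W : Type*} [PartialOrder W] {F : W → ContVal X}
    (hF : ∀ U, ScottContinuous fun w => (F w).toFun U) : ScottContinuous F := by
  intro d hne hd a ha
  refine isLUB_of_pointwise fun U => ?_
  rw [image_image]
  exact hF U hne hd ha

theorem scott_apply (U : Opens X) : ScottContinuous fun ν : ContVal X => ν.toFun U :=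
  fun _ hne hd _ hν => isLUB_apply hne hd hν U

/-! ### Minimal valuations -/

/-- A simple valuation: a finite linear combination of Dirac valuations with coefficients in
`[0, ∞)`. -/
def IsSimple (ν : ContVal X) : Prop :=
  ∃ (n : ℕ) (r : Fin n → ℝ≥0) (x : Fin n → X),
    ∀ U, ν.toFun U = ∑ k, (r k : ℝ≥0∞) * (dirac (x k)).toFun U

/-- The minimal valuations: the smallest set of continuous valuations that contains the simple
valuations and is closed under directed suprema. -/
inductive IsMinimal : ContVal X → Prop
  | simple (ν : ContVal X) : IsSimple ν → IsMinimal ν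
  | sup (D : Set (ContVal X)) (ν : ContVal X) : D.Nonempty → DirectedOn (· ≤ ·) D →
      (∀ μ ∈ D, IsMinimal μ) → IsLUB D ν → IsMinimal ν

theorem IsMinimal.image {F : ContVal X → ContVal Y} (hF : ScottContinuous F)
    (hs : ∀ μ, IsSimple μ → IsMinimal (F μ)) {ν : ContVal X} (hν : IsMinimal ν) :
    IsMinimal (F ν) := by
  induction hν with
  | simple ν h => exact hs ν h
  | sup D ν hne hd _ hlub ih =>
    refine .sup (F '' D) _ (hne.image F) (directedOn_image_mono hd hF.monotone) ?_
      (hF hne hd hlub)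
    rintro _ ⟨μ, hμ, rfl⟩
    exact ih μ hμ

theorem isSimple_dirac (x : X) : IsSimple (dirac x) :=
  ⟨1, fun _ => 1, fun _ => x, fun U => by simp⟩

theorem IsSimple.add {μ ν : ContVal X} (hμ : IsSimple μ) (hν : IsSimple ν) :
    IsSimple (μ.add ν) := by
  obtain ⟨n, r, x, h⟩ := hμ
  obtain ⟨m, s, y, h'⟩ := hν
  refine ⟨n + m, Fin.append r s, Fin.append x y, fun U => ?_⟩
  simp [Fin.sum_univ_add, ContVal.add, h, h']

theorem IsSimple.smul (c : ℝ≥0) {ν : ContVal X} (hν : IsSimple ν) : IsSimple (ν.smul c) := by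
  obtain ⟨n, r, x, h⟩ := hν
  refine ⟨n, fun k => c * r k, x, fun U => ?_⟩
  simp [ContVal.smul, h, Finset.mul_sum, mul_assoc]

theorem IsMinimal.add {μ ν : ContVal X} (hμ : IsMinimal μ) (hν : IsMinimal ν) :
    IsMinimal (μ.add ν) := by
  refine IsMinimal.image (F := fun μ : ContVal X => μ.add ν) (scott_mk fun U =>
    ScottContinuous.comp (ScottContinuous.prodMk (scott_apply U) (ScottContinuous.const
      (ν.toFun U))) scott_add) (fun μ hμ => ?_) hμ
  refine IsMinimal.image (F := fun ν : ContVal X => μ.add ν) (scott_mk fun U =>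
    ScottContinuous.comp (ScottContinuous.prodMk (ScottContinuous.const (μ.toFun U))
      (scott_apply U)) scott_add) (fun ν hν => ?_) hν
  exact .simple _ (hμ.add hν)

theorem IsMinimal.smul (c : ℝ≥0∞) {ν : ContVal X} (hν : IsMinimal ν) : IsMinimal (ν.smul c) := by
  refine IsMinimal.image (F := fun ν : ContVal X => ν.smul c) (scott_mk fun U =>
    ScottContinuous.comp (scott_apply U) (scott_mul c)) (fun ν hν => ?_) hν
  induction c with
  | coe c => exact .simple _ (hν.smul c)
  | top =>
    have hmono : Monotone fun n : ℕ => ν.smul ((n : ℝ≥0) : ℝ≥0∞) := fun n m h U =>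
      mul_le_mul_left (by exact_mod_cast h) _
    refine .sup (range fun n : ℕ => ν.smul ((n : ℝ≥0) : ℝ≥0∞)) _ (range_nonempty _)
      hmono.directed_le.directedOn_range ?_ (isLUB_of_pointwise fun U => ?_)
    · rintro _ ⟨n, rfl⟩
      exact .simple _ (hν.smul _)
    · rw [← range_comp]
      have : (⊤ : ℝ≥0∞) * ν.toFun U = ⨆ n : ℕ, ((n : ℝ≥0) : ℝ≥0∞) * ν.toFun U := by
        rw [← ENNReal.iSup_mul]
        congr 1
        simpa using ENNReal.iSup_natCast.symm
      change IsLUB _ ((⊤ : ℝ≥0∞) * ν.toFun U)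
      rw [this]
      exact isLUB_iSup

/-- The zero valuation. -/
def zero : ContVal X where
  toFun _ := 0
  map_bot := rfl
  modular _ _ := rfl
  scott := ScottContinuous.const _

theorem isSimple_zero : IsSimple (zero : ContVal X) :=
  ⟨0, Fin.elim0, Fin.elim0, fun U => by simp [zero]⟩

theorem IsMinimal.sum {ι : Type*} (s : Finset ι) (c : ι → ℝ≥0∞) {ν : ι → ContVal X}
    (hν : ∀ i, IsMinimal (ν i)) :
    ∃ μ : ContVal X, IsMinimal μ ∧ ∀ U, μ.toFun U = ∑ i ∈ s, c i * (ν i).toFun U := by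
  classical
  induction s using Finset.induction_on with
  | empty => exact ⟨zero, .simple _ isSimple_zero, fun U => by simp [zero]⟩
  | insert i s hi ih =>
    obtain ⟨μ, hμ, h⟩ := ih
    exact ⟨((ν i).smul (c i)).add μ, ((hν i).smul (c i)).add hμ, fun U => by
      simp [Finset.sum_insert hi, ContVal.add, ContVal.smul, h]⟩

/-! ### Integration -/

/-- The open set `h⁻¹ (t, ∞]`, for `h` lower semicontinuous. -/
def superlevel (h : X → ℝ≥0∞) (hh : LowerSemicontinuous h) (t : ℝ) : Opens X :=
  ⟨{x | ENNReal.ofReal t < h x}, hh.isOpen_preimage _⟩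

/-- The integral of a lower semicontinuous map with respect to a continuous valuation, given by
Choquet's formula `∫₀^∞ ν (h⁻¹ (t, ∞]) dt`. -/
noncomputable def integral (ν : ContVal X) (h : X → ℝ≥0∞) (hh : LowerSemicontinuous h) : ℝ≥0∞ :=
  ∫⁻ t in Ioi (0 : ℝ), ν.toFun (superlevel h hh t)

theorem antitone_superlevel (ν : ContVal X) {h : X → ℝ≥0∞} (hh : LowerSemicontinuous h) :
    Antitone fun t => ν.toFun (superlevel h hh t) := fun _ _ hst =>
  ν.scott.monotone fun _ hx => (ENNReal.ofReal_le_ofReal hst).trans_lt hx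

theorem exists_seq_iSup {ι : Type*} [Nonempty ι] (a : ι → ℝ≥0∞) :
    ∃ u : ℕ → ι, ⨆ n, a (u n) = ⨆ i, a i := by
  obtain ⟨u, hu, hlim, hmem⟩ := exists_seq_tendsto_sSup (range_nonempty a) (OrderTop.bddAbove _)
  choose v hv using hmem
  refine ⟨v, ?_⟩
  simp only [hv]
  exact tendsto_nhds_unique (tendsto_atTop_iSup hu) hlim

/-- From a directed family one may extract a chain that dominates a given sequence. -/
theorem exists_chain {ι P : Type*} [PartialOrder P] {g : ι → P} (hg : Directed (· ≤ ·) g)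
    (u : ℕ → ι) : ∃ v : ℕ → ι, Monotone (fun n => g (v n)) ∧ ∀ n, g (u n) ≤ g (v n) := by
  choose w hw₁ hw₂ using hg
  let v : ℕ → ι := fun n => Nat.rec (u 0) (fun n i => w i (u (n + 1))) n
  refine ⟨v, monotone_nat_of_le_succ fun n => hw₁ _ _, fun n => ?_⟩
  cases n with
  | zero => exact le_rfl
  | succ n => exact hw₂ (v n) (u (n + 1))

theorem lintegral_iSup_antitone {ι : Type*} [Nonempty ι] {g : ι → ℝ → ℝ≥0∞}
    (hg : ∀ i, Antitone (g i)) (hd : Directed (· ≤ ·) g) :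
    ∫⁻ t in Ioi (0 : ℝ), ⨆ i, g i t = ⨆ i, ∫⁻ t in Ioi (0 : ℝ), g i t := by
  refine le_antisymm ?_ (iSup_le fun i => lintegral_mono fun t => le_iSup (fun i => g i t) i)
  have hG : Antitone fun t => ⨆ i, g i t := fun s t h => iSup_mono fun i => hg i h
  choose u hu using fun q : ℚ => exists_seq_iSup fun i => g i (q : ℝ)
  obtain ⟨e, he⟩ := exists_surjective_nat (ℚ × ℕ)
  obtain ⟨v, hv, hle⟩ := exists_chain hd fun k => u (e k).1 (e k).2
  have hH : ∀ q : ℚ, ⨆ i, g i (q : ℝ) ≤ ⨆ n, g (v n) (q : ℝ) := fun q => by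
    rw [← hu q]
    refine iSup_le fun n => ?_
    obtain ⟨k, hk⟩ := he (q, n)
    refine le_trans ?_ (le_iSup _ k)
    have := hle k (q : ℝ)
    rwa [hk] at this
  have hae : ∀ᵐ t ∂(volume.restrict (Ioi (0 : ℝ))), ⨆ i, g i t ≤ ⨆ n, g (v n) t := by
    refine ae_restrict_of_ae ?_
    filter_upwards [hG.countable_not_continuousAt.ae_notMem volume] with t ht
    have hc : ContinuousAt (fun t => ⨆ i, g i t) t := by simpa using ht
    refine le_of_tendsto (hc.tendsto.mono_left (nhdsWithin_le_nhds (s := Ioi t))) ?_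
    filter_upwards [self_mem_nhdsWithin] with s hs
    obtain ⟨q, hq₁, hq₂⟩ := exists_rat_btwn (show t < s from hs)
    exact (hG hq₂.le).trans ((hH q).trans (iSup_mono fun n => hg _ hq₁.le))
  calc ∫⁻ t in Ioi (0 : ℝ), ⨆ i, g i t ≤ ∫⁻ t in Ioi (0 : ℝ), ⨆ n, g (v n) t :=
        lintegral_mono_ae hae
    _ = ⨆ n, ∫⁻ t in Ioi (0 : ℝ), g (v n) t :=
        lintegral_iSup (fun n => (hg _).measurable) hv
    _ ≤ _ := iSup_le fun n => le_iSup (fun i => ∫⁻ t in Ioi (0 : ℝ), g i t) (v n)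

/-- The integral is Scott-continuous in the valuation. -/
theorem scott_integral_left (h : X → ℝ≥0∞) (hh : LowerSemicontinuous h) :
    ScottContinuous fun ν : ContVal X => ν.integral h hh := by
  intro D hne hd ν hν
  have : Nonempty D := hne.to_subtype
  have key : ∀ t, ν.toFun (superlevel h hh t) = ⨆ μ : D, μ.1.toFun (superlevel h hh t) :=
    fun t => (isLUB_image_iff_range.1 (isLUB_apply hne hd hν _)).unique isLUB_iSup
  have h2 : ν.integral h hh = ⨆ μ : D, μ.1.integral h hh := by
    unfold integral
    simp only [key]
    exact lintegral_iSup_antitone (fun μ : D => μ.1.antitone_superlevel hh) fun a b => by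
      obtain ⟨c, hc, h1, h2⟩ := hd a.1 a.2 b.1 b.2
      exact ⟨⟨c, hc⟩, fun t => h1 _, fun t => h2 _⟩
  simp only [h2]
  exact isLUB_image_iff_range.2 isLUB_iSup

/-- The integral is Scott-continuous in the integrand. -/
theorem scott_integral_right {W : Type*} [PartialOrder W] (ν : ContVal X) {h : W → X → ℝ≥0∞}
    (hh : ∀ w, LowerSemicontinuous (h w)) (hs : ∀ x, ScottContinuous fun w => h w x) :
    ScottContinuous fun w => ν.integral (h w) (hh w) := by
  intro D hne hd w hw
  have : Nonempty D := hne.to_subtype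
  have hmono : ∀ t, Monotone fun w => superlevel (h w) (hh w) t := fun t a b hab x hx =>
    lt_of_lt_of_le (show ENNReal.ofReal t < h a x from hx) ((hs x).monotone hab)
  have hlub : ∀ t, IsLUB ((fun w => superlevel (h w) (hh w) t) '' D) (superlevel (h w) (hh w) t) := by
    intro t
    refine ⟨?_, fun V hV x hx => ?_⟩
    · rintro _ ⟨a, ha, rfl⟩
      exact hmono t (hw.1 ha)
    · obtain ⟨_, ⟨a, ha, rfl⟩, hlt⟩ := (lt_isLUB_iff (hs x hne hd hw)).1
        (show ENNReal.ofReal t < h w x from hx)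
      exact hV ⟨a, ha, rfl⟩ hlt
  have key : ∀ t, ν.toFun (superlevel (h w) (hh w) t)
      = ⨆ a : D, ν.toFun (superlevel (h a) (hh a) t) := fun t => by
    have := ν.scott (hne.image _) (directedOn_image_mono hd (hmono t)) (hlub t)
    rw [image_image] at this
    exact (isLUB_image_iff_range.1 this).unique isLUB_iSup
  have h2 : ν.integral (h w) (hh w) = ⨆ a : D, ν.integral (h a) (hh a) := by
    unfold integral
    simp only [key]
    exact lintegral_iSup_antitone (fun a : D => ν.antitone_superlevel (hh a)) fun a b => by
      obtain ⟨c, hc, h1, h2⟩ := hd a.1 a.2 b.1 b.2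
      exact ⟨⟨c, hc⟩, fun t => ν.scott.monotone (hmono t h1),
        fun t => ν.scott.monotone (hmono t h2)⟩
  simp only [h2]
  exact isLUB_image_iff_range.2 isLUB_iSup

theorem lintegral_lt (a : ℝ≥0∞) :
    ∫⁻ t in Ioi (0 : ℝ), {t : ℝ | ENNReal.ofReal t < a}.indicator 1 t = a := by
  have hm : MeasurableSet {t : ℝ | ENNReal.ofReal t < a} :=
    ENNReal.measurable_ofReal measurableSet_Iio
  rw [lintegral_indicator_one hm, Measure.restrict_apply hm]
  induction a with
  | top => simp
  | coe a =>
    have : {t : ℝ | ENNReal.ofReal t < (a : ℝ≥0∞)} ∩ Ioi 0 = Ioo 0 (a : ℝ) := by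
      ext t
      simp only [mem_inter_iff, mem_ofPred_eq, mem_Ioi, mem_Ioo]
      constructor
      · rintro ⟨h1, h2⟩
        exact ⟨h2, by
          have := (ENNReal.ofReal_lt_iff_lt_toReal h2.le ENNReal.coe_ne_top).1 h1
          simpa using this⟩
      · rintro ⟨h1, h2⟩
        exact ⟨(ENNReal.ofReal_lt_iff_lt_toReal h1.le ENNReal.coe_ne_top).2 (by simpa using h2), h1⟩
    rw [this, Real.volume_Ioo]
    simp

theorem integral_simple {ν : ContVal X} {n : ℕ} {r : Fin n → ℝ≥0} {x : Fin n → X}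
    (hν : ∀ U, ν.toFun U = ∑ k, (r k : ℝ≥0∞) * (dirac (x k)).toFun U)
    (h : X → ℝ≥0∞) (hh : LowerSemicontinuous h) :
    ν.integral h hh = ∑ k, (r k : ℝ≥0∞) * h (x k) := by
  have hm : ∀ a : ℝ≥0∞, Measurable fun t : ℝ => {t : ℝ | ENNReal.ofReal t < a}.indicator
      (1 : ℝ → ℝ≥0∞) t := fun a =>
    measurable_one.indicator (ENNReal.measurable_ofReal measurableSet_Iio)
  have key : ∀ t, ν.toFun (superlevel h hh t) = ∑ k, (r k : ℝ≥0∞) *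
      {t : ℝ | ENNReal.ofReal t < h (x k)}.indicator (1 : ℝ → ℝ≥0∞) t := fun t => by
    rw [hν]
    rfl
  unfold integral
  simp only [key]
  rw [lintegral_finsetSum _ fun k _ => (hm _).const_mul _]
  refine Finset.sum_congr rfl fun k _ => ?_
  rw [lintegral_const_mul _ (hm _), lintegral_lt]

/-! ### Measures as continuous valuations -/

/-- The restriction to the open sets of a measure on a second-countable space. -/
def ofMeasure [SecondCountableTopology X] [MeasurableSpace X] [OpensMeasurableSpace X]
    (μ : Measure X) : ContVal X where
  toFun U := μ U
  map_bot := by simp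
  modular U V := by
    simpa using measure_union_add_inter (μ := μ) (U : Set X) V.isOpen.measurableSet
  scott := by
    intro d hne hd U hU
    refine ⟨?_, fun b hb => ?_⟩
    · rintro _ ⟨V, hV, rfl⟩
      exact measure_mono (hU.1 hV)
    · obtain ⟨T, hT, hTe⟩ := isOpen_iUnion_countable (fun V : d => (V.1 : Set X))
        fun V => V.1.isOpen
      have hne' : Nonempty d := hne.to_subtype
      obtain ⟨u, hu⟩ : ∃ u : ℕ → d, T ⊆ range u := by
        rcases T.eq_empty_or_nonempty with h | h
        · exact ⟨fun _ => Classical.arbitrary _, by simp [h]⟩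
        · obtain ⟨u, hu⟩ := hT.exists_eq_range h
          exact ⟨u, hu.subset⟩
      obtain ⟨v, hv, hle⟩ := exists_chain (g := fun V : d => V.1)
        (fun a b => by
          obtain ⟨c, hc, h1, h2⟩ := hd a.1 a.2 b.1 b.2
          exact ⟨⟨c, hc⟩, h1, h2⟩) u
      have hsub : (U : Set X) ⊆ ⋃ n, ((v n).1 : Set X) := by
        intro x hx
        rw [hU.unique (isLUB_sSup d)] at hx
        obtain ⟨V, hV, hxV⟩ := Opens.mem_sSup.1 (show x ∈ sSup d from hx)
        have hx' : x ∈ ⋃ V ∈ T, (V.1 : Set X) := by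
          rw [hTe]
          exact mem_iUnion.2 ⟨⟨V, hV⟩, hxV⟩
        simp only [mem_iUnion] at hx'
        obtain ⟨W, hW, hxW⟩ := hx'
        obtain ⟨n, rfl⟩ := hu hW
        exact mem_iUnion.2 ⟨n, hle n hxW⟩
      calc μ U ≤ μ (⋃ n, ((v n).1 : Set X)) := measure_mono hsub
        _ = ⨆ n, μ ((v n).1 : Set X) :=
          Monotone.measure_iUnion (fun n m h => hv h)
        _ ≤ b := iSup_le fun n => hb ⟨(v n).1, (v n).2, rfl⟩

end ContVal

/-! ### Valuations on dcpos -/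

section Scott

open ContVal

variable {X Y W : Type} [PartialOrder X] [PartialOrder Y] [PartialOrder W]

theorem isOpen_scott_iff {U : Set (WithScott X)} : IsOpen U ↔ IsUpperSet U ∧ DirSupInacc U := by
  rw [Topology.IsScott.isOpen_iff_isUpperSet_and_dirSupInaccOn (D := univ), dirSupInaccOn_univ]

theorem isUpperSet_opens (U : Opens (WithScott X)) : IsUpperSet (U : Set (WithScott X)) :=
  (isOpen_scott_iff.1 U.isOpen).1

/-- The dcpo `V_m X` of minimal valuations on `X` with its Scott topology. -/
abbrev MinVal (X : Type) [PartialOrder X] : Type :=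
  {ν : ContVal (WithScott X) // ν.IsMinimal}

theorem MinVal.isLUB_coe {D : Set (MinVal X)} (hne : D.Nonempty)
    (hd : DirectedOn (· ≤ ·) D) : ∃ ν : MinVal X, IsLUB (Subtype.val '' D) ν.1 := by
  have hd' := directedOn_image_mono hd (f := Subtype.val) fun _ _ h => h
  obtain ⟨ν, hν⟩ := IsDcpo.exists_isLUB _ (hne.image Subtype.val) hd'
  refine ⟨⟨ν, .sup _ _ (hne.image _) hd' ?_ hν⟩, hν⟩
  rintro _ ⟨μ, -, rfl⟩
  exact μ.2

theorem MinVal.isLUB_of_coe {D : Set (MinVal X)} {ν : MinVal X}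
    (h : IsLUB (Subtype.val '' D) ν.1) : IsLUB D ν :=
  ⟨fun μ hμ => h.1 ⟨μ, hμ, rfl⟩, fun μ hμ => h.2 (by
    rintro _ ⟨κ, hκ, rfl⟩
    exact hμ hκ)⟩

instance : IsDcpo (MinVal X) where
  exists_isLUB D hne hd := by
    obtain ⟨ν, hν⟩ := MinVal.isLUB_coe hne hd
    exact ⟨ν, MinVal.isLUB_of_coe hν⟩

instance : OrderBot (MinVal X) where
  bot := ⟨zero, .simple _ isSimple_zero⟩
  bot_le _ _ := bot_le

theorem MinVal.scott_val : ScottContinuous (Subtype.val : MinVal X → ContVal (WithScott X)) := by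
  intro D hne hd ν hν
  obtain ⟨μ, hμ⟩ := MinVal.isLUB_coe hne hd
  rw [hν.unique (MinVal.isLUB_of_coe hμ)]
  exact hμ

theorem MinVal.scott_apply (U : Opens (WithScott X)) :
    ScottContinuous fun ν : MinVal X => ν.1.toFun U :=
  ScottContinuous.comp MinVal.scott_val (ContVal.scott_apply U)

theorem MinVal.scott_mk {F : W → MinVal X} (hF : ∀ U, ScottContinuous fun w => (F w).1.toFun U) :
    ScottContinuous F := by
  intro d hne hd a ha
  refine MinVal.isLUB_of_coe ?_
  rw [image_image]
  exact ContVal.scott_mk hF hne hd ha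

theorem lowerSemicontinuous_of_scott {h : X → ℝ≥0∞} (hs : ScottContinuous h) :
    LowerSemicontinuous (fun x : WithScott X => h (WithScott.ofScott x)) := by
  refine lowerSemicontinuous_iff_isOpen_preimage.2 fun t => isOpen_scott_iff.2 ⟨?_, ?_⟩
  · intro x y hxy hx
    exact lt_of_lt_of_le (show t < h x from hx) (hs.monotone hxy)
  · intro d hne hd a ha hlt
    obtain ⟨_, ⟨x, hx, rfl⟩, hlt⟩ := (lt_isLUB_iff (hs hne hd ha)).1
      (show t < h a from hlt)
    exact ⟨x, hx, hlt⟩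

/-- The Dirac valuation, as a minimal valuation. -/
noncomputable def MinVal.dirac (x : X) : MinVal X :=
  ⟨ContVal.dirac (WithScott.toScott x), .simple _ (isSimple_dirac _)⟩

theorem MinVal.scott_dirac : ScottContinuous (MinVal.dirac : X → MinVal X) := by
  refine MinVal.scott_mk fun U d hne hd a ha => ?_
  have hup := isUpperSet_opens U
  have hmono : Monotone fun x : X => (U : Set (WithScott X)).indicator (1 : WithScott X → ℝ≥0∞)
      (WithScott.toScott x) := by
    intro x y hxy
    by_cases hx : WithScott.toScott x ∈ (U : Set (WithScott X))
    · have hy : WithScott.toScott y ∈ (U : Set (WithScott X)) := hup hxy hx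
      simp only [indicator, hx, hy, if_true]
      exact le_rfl
    · simp [indicator, hx]
  constructor
  · rintro _ ⟨x, hx, rfl⟩
    exact hmono (ha.1 hx)
  · intro b hb
    by_cases h : WithScott.toScott a ∈ (U : Set (WithScott X))
    · obtain ⟨x, hx, hxU⟩ := (isOpen_scott_iff.1 U.isOpen).2 hne hd ha h
      calc (MinVal.dirac a).1.toFun U = 1 := indicator_of_mem (M := ℝ≥0∞) h _
        _ = (MinVal.dirac (X := X) x).1.toFun U := (indicator_of_mem hxU (1 : WithScott X → ℝ≥0∞)).symm
        _ ≤ b := hb (mem_image_of_mem (fun x : X => (MinVal.dirac x).1.toFun U) hx)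
    · simp [MinVal.dirac, ContVal.dirac, indicator, h]

/-- A scalar multiple of a minimal valuation. -/
noncomputable def MinVal.smul (c : ℝ≥0∞) (ν : MinVal X) : MinVal X :=
  ⟨ν.1.smul c, ν.2.smul c⟩

/-- The integral `∫ f(x)(V) dμ`. -/
noncomputable def bindAux (f : ScottHom X (MinVal Y)) (μ : ContVal (WithScott X))
    (V : Opens (WithScott Y)) : ℝ≥0∞ :=
  μ.integral (fun x => (f.1 (WithScott.ofScott x)).1.toFun V)
    (lowerSemicontinuous_of_scott (ScottContinuous.comp f.2 (MinVal.scott_apply V)))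

theorem scott_bindAux_left (μ : ContVal (WithScott X)) (V : Opens (WithScott Y)) :
    ScottContinuous fun f : ScottHom X (MinVal Y) => bindAux f μ V :=
  scott_integral_right μ _ fun x =>
    ScottContinuous.comp (ScottHom.scott_apply (WithScott.ofScott x)) (MinVal.scott_apply V)

theorem scott_bindAux_right (f : ScottHom X (MinVal Y)) (V : Opens (WithScott Y)) :
    ScottContinuous fun μ : ContVal (WithScott X) => bindAux f μ V :=
  scott_integral_left _ _

theorem exists_bind (f : ScottHom X (MinVal Y)) {μ : ContVal (WithScott X)} (hμ : μ.IsMinimal) :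
    ∃ ν : MinVal Y, ∀ V, ν.1.toFun V = bindAux f μ V := by
  induction hμ with
  | simple μ h =>
    obtain ⟨n, r, x, h⟩ := h
    obtain ⟨ν, hν, h'⟩ := IsMinimal.sum Finset.univ (fun k => (r k : ℝ≥0∞))
      (ν := fun k => (f.1 (WithScott.ofScott (x k))).1) fun k => (f.1 _).2
    refine ⟨⟨ν, hν⟩, fun V => ?_⟩
    rw [h' V, bindAux, integral_simple h]
  | sup D μ hne hd _ hlub ih =>
    have : ∀ κ : D, ∃ ν : MinVal Y, ∀ V, ν.1.toFun V = bindAux f κ.1 V := fun κ => ih κ.1 κ.2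
    choose G hG using this
    have hne' : Nonempty D := hne.to_subtype
    have hdir : DirectedOn (· ≤ ·) (range G) := by
      rintro _ ⟨a, rfl⟩ _ ⟨b, rfl⟩
      obtain ⟨c, hc, h1, h2⟩ := hd a.1 a.2 b.1 b.2
      refine ⟨G ⟨c, hc⟩, ⟨_, rfl⟩, fun V => ?_, fun V => ?_⟩
      · rw [hG, hG]
        exact (scott_bindAux_right f V).monotone h1
      · rw [hG, hG]
        exact (scott_bindAux_right f V).monotone h2
    obtain ⟨ν, hν⟩ := IsDcpo.exists_isLUB _ (range_nonempty G) hdir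
    refine ⟨ν, fun V => ?_⟩
    have h1 := MinVal.scott_apply V (range_nonempty G) hdir hν
    have h2 := scott_bindAux_right f V hne hd hlub
    rw [← range_comp] at h1
    refine h1.unique ?_
    rw [isLUB_image_iff_range] at h2
    refine (congrArg (fun S => IsLUB S _) (congrArg range (funext fun κ => ?_))).mp h2
    exact (hG κ V).symm

/-- The extension `f†` of the monad of minimal valuations: `f†(μ)(V) = ∫ f(x)(V) dμ`. -/
noncomputable def MinVal.bind (f : ScottHom X (MinVal Y)) (μ : MinVal X) : MinVal Y :=
  ⟨{  toFun := fun V => bindAux f μ.1 V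
      map_bot := by
        obtain ⟨ν, h⟩ := exists_bind f μ.2
        rw [← h, ν.1.map_bot]
      modular := fun U V => by
        obtain ⟨ν, h⟩ := exists_bind f μ.2
        simp only [← h, ν.1.modular]
      scott := by
        obtain ⟨ν, h⟩ := exists_bind f μ.2
        simpa only [← h] using ν.1.scott }, by
    obtain ⟨ν, h⟩ := exists_bind f μ.2
    exact (ContVal.ext' h : ν.1 = ⟨_, _, _, _⟩) ▸ ν.2⟩

theorem MinVal.scott_bind_left (μ : MinVal X) :
    ScottContinuous fun f : ScottHom X (MinVal Y) => MinVal.bind f μ :=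
  MinVal.scott_mk fun V => scott_bindAux_left μ.1 V

theorem MinVal.scott_bind_right (f : ScottHom X (MinVal Y)) :
    ScottContinuous fun μ : MinVal X => MinVal.bind f μ :=
  MinVal.scott_mk fun V => ScottContinuous.comp (g := fun μ => bindAux f μ V) MinVal.scott_val
    (scott_bindAux_right f V)

/-- A criterion for the continuity of a map from a topological space to a dcpo: every value is the
supremum of a chain of elements, each of which is a lower bound of the map near the given point. -/
theorem continuous_of_approx {Z : Type*} [TopologicalSpace Z] {g : Z → WithScott X}
    (h : ∀ z, ∃ a : ℕ → X, Monotone a ∧ IsLUB (range a) (WithScott.ofScott (g z)) ∧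
      ∀ n, ∀ᶠ y in nhds z, a n ≤ WithScott.ofScott (g y)) : Continuous g := by
  refine continuous_def.2 fun U hU => isOpen_iff_mem_nhds.2 fun z hz => ?_
  obtain ⟨a, ha, hlub, hev⟩ := h z
  obtain ⟨hup, hin⟩ := isOpen_scott_iff.1 hU
  obtain ⟨_, ⟨n, rfl⟩, hn⟩ := hin (range_nonempty a) ha.directed_le.directedOn_range hlub hz
  filter_upwards [hev n] with y hy
  exact hup hy hn

end Scott

/-! ### Exact reals -/

/-- The poset of closed intervals `[a, b]` with `a ≤ b`, ordered by reverse inclusion. -/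
abbrev IR : Type := (NonemptyInterval ℝ)ᵒᵈ

/-- The pointed dcpo of exact reals: the lift of `IR`. -/
abbrev IRBot : Type := WithBot IR

/-- The interval `[a, b]` as an element of `IR`. -/
def IR.mk (a b : ℝ) (h : a ≤ b) : IR := OrderDual.toDual ⟨(a, b), h⟩

/-- The left endpoint. -/
def IR.lo (a : IR) : ℝ := (OrderDual.ofDual a).fst

/-- The right endpoint. -/
def IR.hi (a : IR) : ℝ := (OrderDual.ofDual a).snd

theorem IR.lo_le_hi (a : IR) : a.lo ≤ a.hi := (OrderDual.ofDual a).fst_le_snd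

theorem IR.le_iff {a b : IR} : a ≤ b ↔ a.lo ≤ b.lo ∧ b.hi ≤ a.hi := Iff.rfl

theorem IR.isLUB_of {D : Set IR} {a : IR} (h₁ : IsLUB (IR.lo '' D) a.lo)
    (h₂ : IsGLB (IR.hi '' D) a.hi) : IsLUB D a :=
  ⟨fun x hx => ⟨h₁.1 ⟨x, hx, rfl⟩, h₂.1 ⟨x, hx, rfl⟩⟩, fun b hb =>
    ⟨h₁.2 (by rintro _ ⟨x, hx, rfl⟩; exact (IR.le_iff.1 (hb hx)).1),
      h₂.2 (by rintro _ ⟨x, hx, rfl⟩; exact (IR.le_iff.1 (hb hx)).2)⟩⟩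

theorem IR.exists_isLUB {D : Set IR} (hne : D.Nonempty) (hd : DirectedOn (· ≤ ·) D) :
    ∃ a : IR, IsLUB (IR.lo '' D) a.lo ∧ IsGLB (IR.hi '' D) a.hi := by
  have hle : ∀ x ∈ D, ∀ y ∈ D, x.lo ≤ y.hi := fun x hx y hy => by
    obtain ⟨z, -, h1, h2⟩ := hd x hx y hy
    exact (IR.le_iff.1 h1).1.trans (z.lo_le_hi.trans (IR.le_iff.1 h2).2)
  obtain ⟨x, hx⟩ := id hne
  have hb : BddAbove (IR.lo '' D) := ⟨x.hi, by rintro _ ⟨y, hy, rfl⟩; exact hle y hy x hx⟩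
  have hb' : BddBelow (IR.hi '' D) := ⟨x.lo, by rintro _ ⟨y, hy, rfl⟩; exact hle x hx y hy⟩
  have h₁ := isLUB_csSup (hne.image IR.lo) hb
  have h₂ := isGLB_csInf (hne.image IR.hi) hb'
  refine ⟨IR.mk _ _ (h₁.2 ?_), h₁, h₂⟩
  rintro _ ⟨y, hy, rfl⟩
  refine h₂.2 ?_
  rintro _ ⟨z, hz, rfl⟩
  exact hle y hy z hz

instance : IsDcpo IR where
  exists_isLUB D hne hd := by
    obtain ⟨a, h₁, h₂⟩ := IR.exists_isLUB hne hd
    exact ⟨a, IR.isLUB_of h₁ h₂⟩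

theorem IR.scott_lo : ScottContinuous IR.lo := by
  intro D hne hd a ha
  obtain ⟨b, h₁, h₂⟩ := IR.exists_isLUB hne hd
  rw [ha.unique (IR.isLUB_of h₁ h₂)]
  exact h₁

theorem IR.scott_neg_hi : ScottContinuous fun a : IR => -a.hi := by
  intro D hne hd a ha
  obtain ⟨b, h₁, h₂⟩ := IR.exists_isLUB hne hd
  rw [ha.unique (IR.isLUB_of h₁ h₂), ← image_image (fun x : ℝ => -x) IR.hi, image_neg_eq_neg]
  exact isLUB_neg.2 (by simpa using h₂)

/-- The magnitude `|𝐚|`: it is `a` on `[a, b]` if `a ≥ 0`, `-b` on `[a, b]` if `b ≤ 0`, and `0` on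
`⊥` and on the remaining intervals. -/
noncomputable def absIR : IRBot → ℝ≥0∞ :=
  strictExt fun a : IR => ENNReal.ofReal (max a.lo (-a.hi))

theorem scott_ofReal : ScottContinuous ENNReal.ofReal := by
  intro D hne _ a ha
  exact ha.isLUB_of_tendsto (fun _ _ _ _ h => ENNReal.ofReal_le_ofReal h) hne
    (ENNReal.continuous_ofReal.continuousWithinAt)

theorem scott_absIR : ScottContinuous absIR :=
  scott_strictExt (ScottContinuous.comp (g := ENNReal.ofReal) (ScottContinuous.comp
    (g := fun b : ℝ × ℝ => max b.1 b.2) (ScottContinuous.prodMk IR.scott_lo IR.scott_neg_hi) ScottContinuous.sup₂) scott_ofReal)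

/-- The embedding `i(x) = [x, x]` of the reals into the exact reals. -/
def iReal (x : ℝ) : IRBot := (IR.mk x x le_rfl : IR)

/-- The interval of radius `1 / (n + 1)` around `x`. -/
noncomputable def around (x : ℝ) (n : ℕ) : IR :=
  IR.mk (x - 1 / (n + 1)) (x + 1 / (n + 1)) (by
    have : (0 : ℝ) < 1 / (n + 1) := Nat.one_div_pos_of_nat
    linarith)

theorem around_mono (x : ℝ) : Monotone (around x) := fun n m h => by
  have : (1 : ℝ) / (m + 1) ≤ 1 / (n + 1) := Nat.one_div_le_one_div h
  exact IR.le_iff.2 ⟨sub_le_sub_left this x, add_le_add_right this x⟩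

theorem around_le (x : ℝ) (n : ℕ) : ∀ᶠ y in nhds x, (around x n : IRBot) ≤ iReal y := by
  have : (0 : ℝ) < 1 / (n + 1) := Nat.one_div_pos_of_nat
  filter_upwards [Icc_mem_nhds (show x - 1 / (n + 1 : ℝ) < x by linarith)
    (show x < x + 1 / (n + 1 : ℝ) by linarith)] with y hy
  exact WithBot.coe_le_coe.2 (IR.le_iff.2 hy)

theorem isLUB_around (x : ℝ) (u : Set ℕ) (hu : ∀ n, ∃ m ∈ u, n ≤ m) :
    IsLUB ((fun n => (around x n : IRBot)) '' u) (iReal x) := by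
  have hpos : ∀ n : ℕ, (0 : ℝ) < 1 / (n + 1) := fun n => Nat.one_div_pos_of_nat
  have h : IsLUB (around x '' u) (IR.mk x x le_rfl) := by
    have key : ∀ c : ℝ, (∀ n ∈ u, c ≤ 1 / ((n : ℝ) + 1)) → c ≤ 0 := fun c hc =>
      le_of_forall_pos_le_add fun ε hε => by
        obtain ⟨n, hn⟩ := exists_nat_one_div_lt hε
        obtain ⟨m, hm, hnm⟩ := hu n
        have : (1 : ℝ) / (m + 1) ≤ 1 / (n + 1) := Nat.one_div_le_one_div hnm
        linarith [hc m hm]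
    refine ⟨?_, fun b hb => IR.le_iff.2 ⟨?_, ?_⟩⟩
    · rintro _ ⟨n, -, rfl⟩
      exact IR.le_iff.2 ⟨by simpa [around, IR.mk, IR.lo] using (hpos n).le,
        by simpa [around, IR.mk, IR.hi] using (hpos n).le⟩
    · have := key (x - b.lo) fun n hn => by
        have : x - 1 / ((n : ℝ) + 1) ≤ b.lo := (IR.le_iff.1 (hb ⟨n, hn, rfl⟩)).1
        linarith
      have h' : x ≤ b.lo := by linarith
      exact h'
    · have := key (b.hi - x) fun n hn => by
        have : b.hi ≤ x + 1 / ((n : ℝ) + 1) := (IR.le_iff.1 (hb ⟨n, hn, rfl⟩)).2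
        linarith
      have h' : b.hi ≤ x := by linarith
      exact h'
  have hne : u.Nonempty := by
    obtain ⟨m, hm, -⟩ := hu 0
    exact ⟨m, hm⟩
  have hdir : DirectedOn (· ≤ ·) (around x '' u) := by
    rintro _ ⟨n, hn, rfl⟩ _ ⟨m, hm, rfl⟩
    rcases le_total n m with h | h
    · exact ⟨_, ⟨m, hm, rfl⟩, around_mono x h, le_rfl⟩
    · exact ⟨_, ⟨n, hn, rfl⟩, le_rfl, around_mono x h⟩
  have := scott_coe (hne.image _) hdir h
  rwa [image_image] at this

/-- The embedding `i`, as a continuous map. -/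
def iEmb : C(ℝ, WithScott IRBot) where
  toFun x := WithScott.toScott (iReal x)
  continuous_toFun := continuous_of_approx fun x => by
    refine ⟨fun n => (around x n : IRBot), fun n m h => WithBot.coe_le_coe.2 (around_mono x h), ?_,
      around_le x⟩
    rw [← image_univ]
    exact isLUB_around x univ fun n => ⟨n, mem_univ _, le_rfl⟩

/-- The dyadic interval `[z / 2ⁿ, (z + 1) / 2ⁿ]`. -/
noncomputable def dyadic (n : ℕ) (z : ℤ) : IRBot :=
  (IR.mk (z / 2 ^ n) ((z + 1) / 2 ^ n) (by gcongr; linarith) : IR)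

theorem mem_dyadic {n : ℕ} {z : ℤ} {x : ℝ} :
    x ∈ Ico ((z : ℝ) / 2 ^ n) ((z + 1) / 2 ^ n) ↔ ⌊x * 2 ^ n⌋ = z := by
  have h : (0 : ℝ) < 2 ^ n := by positivity
  rw [Int.floor_eq_iff, mem_Ico, div_le_iff₀ h, lt_div_iff₀ h]

theorem dyadic_succ (n : ℕ) (x : ℝ) :
    dyadic n ⌊x * 2 ^ n⌋ ≤ dyadic (n + 1) ⌊x * 2 ^ (n + 1)⌋ := by
  have h : (0 : ℝ) < 2 ^ n := by positivity
  have h' : (0 : ℝ) < 2 ^ (n + 1) := by positivity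
  have e : x * 2 ^ (n + 1) = 2 * (x * 2 ^ n) := by ring
  set y := x * 2 ^ n
  have h1 : 2 * ⌊y⌋ ≤ ⌊x * 2 ^ (n + 1)⌋ := by
    rw [e, Int.le_floor]
    push_cast
    linarith [Int.floor_le y]
  have h2 : ⌊x * 2 ^ (n + 1)⌋ + 1 ≤ 2 * (⌊y⌋ + 1) := by
    have : ⌊x * 2 ^ (n + 1)⌋ < 2 * (⌊y⌋ + 1) := by
      rw [e, Int.floor_lt]
      push_cast
      linarith [Int.lt_floor_add_one y]
    omega
  have h1' : (2 * ⌊y⌋ : ℝ) ≤ ⌊x * 2 ^ (n + 1)⌋ := by exact_mod_cast h1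
  have h2' : (⌊x * 2 ^ (n + 1)⌋ + 1 : ℝ) ≤ 2 * (⌊y⌋ + 1) := by exact_mod_cast h2
  refine WithBot.coe_le_coe.2 (IR.le_iff.2 ⟨?_, ?_⟩)
  · generalize ⌊x * 2 ^ (n + 1)⌋ = w at h1' h2'
    change (⌊y⌋ : ℝ) / 2 ^ n ≤ w / 2 ^ (n + 1)
    rw [div_le_div_iff₀ h h', show (2 : ℝ) ^ (n + 1) = 2 * 2 ^ n by ring]
    nlinarith
  · generalize ⌊x * 2 ^ (n + 1)⌋ = w at h1' h2'
    change (w + 1 : ℝ) / 2 ^ (n + 1) ≤ (⌊y⌋ + 1) / 2 ^ n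
    rw [div_le_div_iff₀ h' h, show (2 : ℝ) ^ (n + 1) = 2 * 2 ^ n by ring]
    nlinarith

theorem dyadic_le (n : ℕ) (x : ℝ) : dyadic n ⌊x * 2 ^ n⌋ ≤ iReal x := by
  have := (mem_dyadic (n := n) (z := ⌊x * 2 ^ n⌋) (x := x)).2 rfl
  exact WithBot.coe_le_coe.2 (IR.le_iff.2 ⟨this.1, this.2.le⟩)

theorem isLUB_dyadic (x : ℝ) : IsLUB (range fun n : ℕ => dyadic n ⌊x * 2 ^ n⌋) (iReal x) := by
  refine ⟨?_, fun b hb => ?_⟩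
  · rintro _ ⟨n, rfl⟩
    exact dyadic_le n x
  · induction b using WithBot.recBotCoe with
    | bot => exact absurd (hb ⟨0, rfl⟩) (by simp [dyadic])
    | coe b =>
      have hb' : ∀ n : ℕ, (⌊x * 2 ^ n⌋ : ℝ) / 2 ^ n ≤ b.lo ∧ b.hi ≤ (⌊x * 2 ^ n⌋ + 1) / 2 ^ n :=
        fun n => IR.le_iff.1 (WithBot.coe_le_coe.1 (hb ⟨n, rfl⟩))
      have hx : ∀ n : ℕ, (⌊x * 2 ^ n⌋ : ℝ) / 2 ^ n ≤ x ∧ x ≤ (⌊x * 2 ^ n⌋ + 1) / 2 ^ n :=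
        fun n => ⟨(mem_dyadic.2 rfl).1, (mem_dyadic.2 rfl).2.le⟩
      have key : ∀ c : ℝ, (∀ n : ℕ, c ≤ (1 / 2) ^ n) → c ≤ 0 := fun c hc =>
        le_of_forall_pos_le_add fun ε hε => by
          obtain ⟨n, hn⟩ := exists_pow_lt_of_lt_one hε (show (1 / 2 : ℝ) < 1 by norm_num)
          linarith [hc n]
      have hw : ∀ n : ℕ, ((⌊x * 2 ^ n⌋ : ℝ) + 1) / 2 ^ n = ⌊x * 2 ^ n⌋ / 2 ^ n + (1 / 2) ^ n :=
        fun n => by rw [add_div, one_div_pow]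
      have h1 := key (x - b.lo) fun n => by linarith [hb' n, hx n, hw n]
      have h2 := key (b.hi - x) fun n => by linarith [hb' n, hx n, hw n]
      have h1' : x ≤ b.lo := by linarith
      have h2' : b.hi ≤ x := by linarith
      exact WithBot.coe_le_coe.2 (IR.le_iff.2 ⟨h1', h2'⟩)

/-- The image under `i` of any measure on the reals is a minimal valuation. -/
theorem isMinimal_sample (μ : Measure ℝ) : ((ContVal.ofMeasure μ).map iEmb).IsMinimal := by
  classical
  have hν : ∀ n : ℕ, ∃ ν : ContVal (WithScott IRBot), ν.IsMinimal ∧ ∀ U, ν.toFun U =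
      ∑ z ∈ Finset.Ico (-(n * 2 ^ n : ℤ)) (n * 2 ^ n), μ (Ico ((z : ℝ) / 2 ^ n) ((z + 1) / 2 ^ n)) *
        (ContVal.dirac (WithScott.toScott (dyadic n z))).toFun U := fun n =>
    ContVal.IsMinimal.sum _ _ fun z => .simple _ (ContVal.isSimple_dirac _)
  choose ν hmin hν using hν
  let A : Opens (WithScott IRBot) → ℕ → Set ℝ := fun U n =>
    {x | ⌊x * 2 ^ n⌋ ∈ Finset.Ico (-(n * 2 ^ n : ℤ)) (n * 2 ^ n) ∧
      WithScott.toScott (dyadic n ⌊x * 2 ^ n⌋) ∈ U}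
  have hA : ∀ n U, (ν n).toFun U = μ (A U n) := by
    intro n U
    have e : A U n = ⋃ z ∈ (Finset.Ico (-(n * 2 ^ n : ℤ)) (n * 2 ^ n)).filter
        (fun z => WithScott.toScott (dyadic n z) ∈ U),
        Ico ((z : ℝ) / 2 ^ n) ((z + 1) / 2 ^ n) := by
      ext x
      simp only [mem_iUnion, exists_prop, mem_dyadic, Finset.mem_filter]
      constructor
      · intro h
        exact ⟨_, h, rfl⟩
      · rintro ⟨z, h, rfl⟩
        exact h
    rw [e, measure_biUnion_finset ?_ fun z _ => measurableSet_Ico, Finset.sum_filter, hν]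
    · refine Finset.sum_congr rfl fun z _ => ?_
      by_cases h : WithScott.toScott (dyadic n z) ∈ U <;>
        simp [ContVal.dirac, indicator, h]
    · intro z _ w _ hzw
      refine Set.disjoint_left.2 fun x hx hx' => hzw ?_
      rw [← mem_dyadic.1 hx, ← mem_dyadic.1 hx']
  have hmem : ∀ (n : ℕ) (x : ℝ), ⌊x * 2 ^ n⌋ ∈ Finset.Ico (-(n * 2 ^ n : ℤ)) (n * 2 ^ n) ↔
      -(n : ℝ) ≤ x ∧ x < n := by
    intro n x
    have h : (0 : ℝ) < 2 ^ n := by positivity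
    rw [Finset.mem_Ico, Int.le_floor, Int.floor_lt]
    push_cast
    rw [← neg_mul, mul_le_mul_iff_left₀ h, mul_lt_mul_iff_left₀ h]
  have hAmono : ∀ U, Monotone (A U) := by
    intro U
    refine monotone_nat_of_le_succ fun n x hx => ⟨(hmem _ _).2 ?_, ?_⟩
    · have := (hmem _ _).1 hx.1
      push_cast
      constructor <;> linarith [this.1, this.2]
    · exact isUpperSet_opens U (dyadic_succ n x) hx.2
  have hAU : ∀ U, ((Opens.comap iEmb U : Opens ℝ) : Set ℝ) = ⋃ n, A U n := by
    intro U
    ext x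
    rw [mem_iUnion]
    constructor
    · intro hx
      obtain ⟨_, ⟨n, rfl⟩, hn⟩ := (isOpen_scott_iff.1 U.isOpen).2 (range_nonempty _)
        (monotone_nat_of_le_succ fun n => dyadic_succ n x).directed_le.directedOn_range
        (isLUB_dyadic x) hx
      obtain ⟨m, hm⟩ := exists_nat_gt |x|
      refine ⟨max n m, (hmem _ _).2 ?_, isUpperSet_opens U ((monotone_nat_of_le_succ
        fun n => dyadic_succ n x) (le_max_left n m)) hn⟩
      have h1 : (m : ℝ) ≤ (max n m : ℕ) := by exact_mod_cast le_max_right n m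
      have h2 := abs_lt.1 (hm.trans_le h1)
      exact ⟨h2.1.le, h2.2⟩
    · rintro ⟨n, hn⟩
      exact isUpperSet_opens U (dyadic_le n x) hn.2
  have hmono : Monotone ν := fun n m h U => by
    rw [hA, hA]
    exact measure_mono (hAmono U h)
  refine .sup (range ν) _ (range_nonempty ν) hmono.directed_le.directedOn_range ?_
    (ContVal.isLUB_of_pointwise fun U => ?_)
  · rintro _ ⟨n, rfl⟩
    exact hmin n
  · rw [← range_comp]
    have : ((ContVal.ofMeasure μ).map iEmb).toFun U = ⨆ n, (ν n).toFun U := by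
      change μ ((Opens.comap iEmb U : Opens ℝ) : Set ℝ) = _
      simp only [hAU, hA]
      exact (hAmono U).measure_iUnion
    rw [this]
    exact isLUB_iSup

/-! ### Types -/

/-- The types of the calculus. -/
inductive Ty : Type
  | unit
  | void
  | int
  | real
  | sum (σ τ : Ty)
  | prod (σ τ : Ty)
  | arr (σ τ : Ty)
  | dist (τ : Ty)

/-- A pointed dcpo. -/
structure PDcpo where
  /-- The underlying set. -/
  carrier : Type
  [order : PartialOrder carrier]
  [bot : OrderBot carrier]
  [dcpo : IsDcpo carrier]

attribute [instance] PDcpo.order PDcpo.bot PDcpo.dcpo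

/-- The semantics of types. -/
def Ty.dom : Ty → PDcpo
  | .unit => ⟨WithBot (Flat Unit)⟩
  | .void => ⟨PUnit⟩
  | .int => ⟨WithBot (Flat ℤ)⟩
  | .real => ⟨IRBot⟩
  | .sum σ τ => ⟨WithBot (σ.dom.carrier ⊕ τ.dom.carrier)⟩
  | .prod σ τ => ⟨σ.dom.carrier × τ.dom.carrier⟩
  | .arr σ τ => ⟨ScottHom σ.dom.carrier τ.dom.carrier⟩
  | .dist τ => ⟨MinVal τ.dom.carrier⟩

/-- The dcpo `⟦τ⟧`. -/
abbrev Ty.Den (τ : Ty) : Type := τ.dom.carrier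

/-- The element `*` of `⟦unit⟧`. -/
def starVal : Ty.unit.Den := ((⟨()⟩ : Flat Unit) : WithBot (Flat Unit))

/-- The integer `n` as an element of `⟦int⟧`. -/
def intVal (n : ℤ) : Ty.int.Den := ((⟨n⟩ : Flat ℤ) : WithBot (Flat ℤ))

/-- The real number `x` as an element of `⟦real⟧`. -/
def realVal (x : ℝ) : Ty.real.Den := iReal x

/-- Application of an element of `⟦σ → τ⟧`. -/
def Ty.Den.app {σ τ : Ty} (f : (Ty.arr σ τ).Den) (x : σ.Den) : τ.Den :=
  (show ScottHom σ.Den τ.Den from f).1 x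

/-- The continuous valuation underlying an element of `⟦D τ⟧`. -/
def Ty.Den.val {τ : Ty} (ν : (Ty.dist τ).Den) : ContVal (WithScott τ.Den) :=
  (show MinVal τ.Den from ν).1

/-! ### Terms -/

/-- The parameters of the calculus: the constants of each type together with their semantics (among
them the constants `*` and `n`, for every integer `n`), and the set of measures from which one may
sample. -/
structure Signature where
  /-- The constants of type `τ`. -/
  Const : Ty → Type
  /-- The semantics of constants. -/
  den {τ : Ty} : Const τ → τ.Den
  /-- The constant `*`. -/
  star : Const Ty.unit
  den_star : den star = starVal
  /-- The integer constants. -/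
  num : ℤ → Const Ty.int
  den_num : ∀ n, den (num n) = intVal n
  /-- The measures on the reals from which one may sample. -/
  measures : Set (Measure ℝ)

/-- The variables: countably many of each type. -/
abbrev Var : Type := Ty × ℕ

/-- The well-typed terms. -/
inductive Term (S : Signature) : Ty → Type
  | var (σ : Ty) (n : ℕ) : Term S σ
  | const {τ : Ty} (f : S.Const τ) : Term S τ
  | sample (μ : Measure ℝ) (hμ : μ ∈ S.measures) : Term S (.dist .real)
  | score (M : Term S .real) : Term S (.dist .unit)
  | lam (σ : Ty) (n : ℕ) {τ : Ty} (M : Term S τ) : Term S (.arr σ τ)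
  | app {σ τ : Ty} (M : Term S (.arr σ τ)) (N : Term S σ) : Term S τ
  | fix {σ : Ty} (M : Term S (.arr σ σ)) : Term S σ
  | ret {τ : Ty} (M : Term S τ) : Term S (.dist τ)
  | bind (σ : Ty) (n : ℕ) {τ : Ty} (M : Term S (.dist σ)) (N : Term S (.dist τ)) :
      Term S (.dist τ)
  | pair {σ τ : Ty} (M : Term S σ) (N : Term S τ) : Term S (.prod σ τ)
  | fst {σ τ : Ty} (M : Term S (.prod σ τ)) : Term S σ
  | snd {σ τ : Ty} (M : Term S (.prod σ τ)) : Term S τ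
  | inl {σ τ : Ty} (M : Term S σ) : Term S (.sum σ τ)
  | inr {σ τ : Ty} (M : Term S τ) : Term S (.sum σ τ)
  | case {σ τ υ : Ty} (M : Term S (.sum σ τ)) (N : Term S (.arr σ υ)) (P : Term S (.arr τ υ)) :
      Term S υ

/-- Environments. -/
abbrev Env : Type := ∀ v : Var, v.1.Den

noncomputable instance : DecidableEq Ty := Classical.decEq _

/-- The environment `ρ[x_σ ↦ V]`. -/
noncomputable def Env.set (ρ : Env) (σ : Ty) (n : ℕ) (V : σ.Den) : Env :=
  Function.update ρ (σ, n) V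

theorem Env.scott_set_left (σ : Ty) (n : ℕ) (V : σ.Den) :
    ScottContinuous fun ρ : Env => ρ.set σ n V := by
  refine scott_pi fun v => ?_
  by_cases h : v = (σ, n)
  · subst h
    simp [Env.set]
  · simpa [Env.set, Function.update_of_ne h] using scott_eval (π := fun v : Var => v.1.Den) v

theorem Env.scott_set_right (ρ : Env) (σ : Ty) (n : ℕ) :
    ScottContinuous fun V : σ.Den => ρ.set σ n V := by
  refine scott_pi fun v => ?_
  by_cases h : v = (σ, n)
  · subst h
    simp [Env.set]
  · simp [Env.set, Function.update_of_ne h]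

/-! ### Denotations -/

namespace Sem

variable {W X Y Z : Type} [PartialOrder W] [PartialOrder X] [PartialOrder Y] [PartialOrder Z]

/-- Case analysis: `N a` on `(1, a)`, `P b` on `(2, b)`, and `⊥` otherwise. -/
def caseOf [OrderBot Z] (s : WithBot (X ⊕ Y)) (N : ScottHom X Z) (P : ScottHom Y Z) : Z :=
  strictExt (Sum.elim N.1 P.1) s

theorem scott_caseOf_fun [OrderBot Z] [IsDcpo Z] (s : WithBot (X ⊕ Y)) :
    ScottContinuous fun p : ScottHom X Z × ScottHom Y Z => caseOf s p.1 p.2 := by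
  induction s using WithBot.recBotCoe with
  | bot => exact ScottContinuous.const ⊥
  | coe s =>
    cases s with
    | inl a =>
      exact ScottContinuous.comp (g := fun f : ScottHom X Z => f.1 a) ScottContinuous.fst
        (ScottHom.scott_apply a)
    | inr b =>
      exact ScottContinuous.comp (g := fun f : ScottHom Y Z => f.1 b) ScottContinuous.snd
        (ScottHom.scott_apply b)

/-- `w ↦ M(w)(N(w))`. -/
def app [IsDcpo Y] (M : ScottHom W (ScottHom X Y)) (N : ScottHom W X) : ScottHom W Y :=
  ⟨fun w => (M.1 w).1 (N.1 w), scott_comp₂ (g := fun (f : ScottHom X Y) x => f.1 x)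
    (fun x => ScottHom.scott_apply x) (fun f => f.2) M.2 N.2⟩

/-- `w ↦ lfp (M(w))`. -/
noncomputable def fix [OrderBot X] [IsDcpo X] (M : ScottHom W (ScottHom X X)) : ScottHom W X :=
  ⟨fun w => lfp (M.1 w), ScottContinuous.comp M.2 scott_lfp⟩

/-- `w ↦ δ_{M(w)}`. -/
noncomputable def ret (M : ScottHom W X) : ScottHom W (MinVal X) :=
  ⟨fun w => MinVal.dirac (M.1 w), ScottContinuous.comp M.2 MinVal.scott_dirac⟩

/-- `w ↦ N(w)†(M(w))`. -/
noncomputable def bind (M : ScottHom W (MinVal X)) (N : ScottHom W (ScottHom X (MinVal Y))) :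
    ScottHom W (MinVal Y) :=
  ⟨fun w => MinVal.bind (N.1 w) (M.1 w), scott_comp₂ (g := fun f μ => MinVal.bind f μ)
    MinVal.scott_bind_left MinVal.scott_bind_right N.2 M.2⟩

/-- `w ↦ |M(w)| δ_x`. -/
noncomputable def score (x : X) (M : ScottHom W IRBot) : ScottHom W (MinVal X) :=
  ⟨fun w => (MinVal.dirac x).smul (absIR (M.1 w)), MinVal.scott_mk fun U => by
    have := ScottContinuous.comp (ScottContinuous.comp M.2 scott_absIR)
      (scott_mul ((MinVal.dirac x).1.toFun U))
    refine (congrArg ScottContinuous (funext fun w => ?_)).mp this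
    exact mul_comm _ _⟩

/-- `w ↦ (M(w), N(w))`. -/
def pair (M : ScottHom W X) (N : ScottHom W Y) : ScottHom W (X × Y) :=
  ⟨fun w => (M.1 w, N.1 w), ScottContinuous.prodMk M.2 N.2⟩

/-- `w ↦ π₁ (M(w))`. -/
def fst (M : ScottHom W (X × Y)) : ScottHom W X :=
  ⟨fun w => (M.1 w).1, ScottContinuous.comp M.2 ScottContinuous.fst⟩

/-- `w ↦ π₂ (M(w))`. -/
def snd (M : ScottHom W (X × Y)) : ScottHom W Y :=
  ⟨fun w => (M.1 w).2, ScottContinuous.comp M.2 ScottContinuous.snd⟩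

/-- `w ↦ (1, M(w))`. -/
def inl (M : ScottHom W X) : ScottHom W (WithBot (X ⊕ Y)) :=
  ⟨fun w => (Sum.inl (M.1 w) : X ⊕ Y),
    ScottContinuous.comp (g := fun x => ((Sum.inl x : X ⊕ Y) : WithBot (X ⊕ Y))) M.2
      (ScottContinuous.comp (g := WithBot.some) scott_inl scott_coe)⟩

/-- `w ↦ (2, M(w))`. -/
def inr (M : ScottHom W Y) : ScottHom W (WithBot (X ⊕ Y)) :=
  ⟨fun w => (Sum.inr (M.1 w) : X ⊕ Y),
    ScottContinuous.comp (g := fun x => ((Sum.inr x : X ⊕ Y) : WithBot (X ⊕ Y))) M.2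
      (ScottContinuous.comp (g := WithBot.some) scott_inr scott_coe)⟩

/-- `w ↦ case M(w) N(w) P(w)`. -/
def case [OrderBot Z] [IsDcpo Z] (M : ScottHom W (WithBot (X ⊕ Y)))
    (N : ScottHom W (ScottHom X Z)) (P : ScottHom W (ScottHom Y Z)) : ScottHom W Z :=
  ⟨fun w => caseOf (M.1 w) (N.1 w) (P.1 w), scott_comp₂
    (g := fun s (p : ScottHom X Z × ScottHom Y Z) => caseOf s p.1 p.2)
    (fun p => scott_strictExt (scott_sumElim p.1.2 p.2.2)) scott_caseOf_fun M.2
    (ScottContinuous.prodMk N.2 P.2)⟩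

/-- `ρ ↦ (V ↦ M(ρ[x_σ ↦ V]))`. -/
noncomputable def lam (σ : Ty) (n : ℕ) (M : ScottHom Env X) : ScottHom Env (ScottHom σ.Den X) :=
  ⟨fun ρ => ⟨fun V => M.1 (ρ.set σ n V), ScottContinuous.comp (Env.scott_set_right ρ σ n) M.2⟩,
    ScottHom.scott_mk fun V => ScottContinuous.comp (Env.scott_set_left σ n V) M.2⟩

/-- The minimal valuation `i[μ]`. -/
noncomputable def sample (μ : Measure ℝ) : MinVal IRBot :=
  ⟨(ContVal.ofMeasure μ).map iEmb, isMinimal_sample μ⟩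

end Sem

/-- The denotation `⟦M⟧` of a term, a Scott-continuous function of the environment. -/
noncomputable def Term.sem {S : Signature} : {τ : Ty} → Term S τ → ScottHom Env τ.Den
  | _, .var σ n => ⟨fun ρ => ρ (σ, n), scott_eval (π := fun v : Var => v.1.Den) (σ, n)⟩
  | _, .const f => ⟨fun _ => S.den f, ScottContinuous.const _⟩
  | _, .sample μ _ => ⟨fun _ => Sem.sample μ, ScottContinuous.const (Sem.sample μ)⟩
  | _, .score M => Sem.score starVal M.sem
  | _, .lam σ n M => Sem.lam σ n M.sem
  | _, .app M N => Sem.app M.sem N.sem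
  | _, .fix M => Sem.fix M.sem
  | _, .ret M => Sem.ret M.sem
  | _, .bind σ n M N => Sem.bind M.sem (Sem.lam σ n N.sem)
  | _, .pair M N => Sem.pair M.sem N.sem
  | _, .fst M => Sem.fst M.sem
  | _, .snd M => Sem.snd M.sem
  | _, .inl M => Sem.inl M.sem
  | _, .inr M => Sem.inr M.sem
  | _, .case M N P => Sem.case M.sem N.sem P.sem

/-- The value `⟦M⟧ρ`. -/
noncomputable def Term.eval {S : Signature} {τ : Ty} (M : Term S τ) (ρ : Env) : τ.Den :=
  M.sem.1 ρ

/-! ### Sequences of uniform random reals -/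

/-- The uniform measure `λ₁` on `[0, 1]`, as a measure on the reals. -/
noncomputable def lam₁ : Measure ℝ := volume.restrict (Icc 0 1)

instance : IsProbabilityMeasure lam₁ := ⟨by simp [lam₁]⟩

/-- The infinite product `λ₁^∞`, as a measure on the space of sequences of reals. -/
noncomputable def lam₁Inf : Measure (ℕ → ℝ) := Measure.infinitePi fun _ => lam₁

/-- The sequence `x` as an element of `⟦int → real⟧`: it maps `n ≥ 0` to `i(x_n)`, and the negative
integers and `⊥` to `⊥`. -/
def seqVal (x : ℕ → ℝ) : (Ty.arr Ty.int Ty.real).Den :=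
  (⟨strictExt fun n : Flat ℤ => match n.val with
    | Int.ofNat k => iReal (x k)
    | Int.negSucc _ => ⊥, scott_strictExt (scott_flat _)⟩ : ScottHom (WithBot (Flat ℤ)) IRBot)

/-- A chain of elements of `⟦int → real⟧` with supremum `seqVal x`. -/
noncomputable def seqApprox (x : ℕ → ℝ) (N : ℕ) : ScottHom (WithBot (Flat ℤ)) IRBot :=
  ⟨strictExt fun n : Flat ℤ => match n.val with
    | Int.ofNat k => if k ≤ N then (around (x k) N : IRBot) else ⊥
    | Int.negSucc _ => ⊥, scott_strictExt (scott_flat _)⟩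

theorem seqApprox_mono (x : ℕ → ℝ) : Monotone (seqApprox x) := by
  intro N M h n
  induction n using WithBot.recBotCoe with
  | bot => exact le_rfl
  | coe n =>
    obtain ⟨k | k⟩ := n
    · change (if k ≤ N then (around (x k) N : IRBot) else ⊥)
        ≤ (if k ≤ M then (around (x k) M : IRBot) else ⊥)
      by_cases hk : k ≤ N
      · rw [if_pos hk, if_pos (hk.trans h)]
        exact WithBot.coe_le_coe.2 (around_mono _ h)
      · rw [if_neg hk]
        exact bot_le
    · exact le_rfl

theorem isLUB_seqApprox (x : ℕ → ℝ) :
    IsLUB (range (seqApprox x)) (show ScottHom (WithBot (Flat ℤ)) IRBot from seqVal x) := by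
  refine ScottHom.isLUB_of_pointwise fun n => ?_
  rw [← range_comp]
  induction n using WithBot.recBotCoe with
  | bot =>
    refine ⟨?_, fun _ _ => bot_le⟩
    rintro _ ⟨N, rfl⟩
    exact le_rfl
  | coe n =>
    obtain ⟨k | k⟩ := n
    · have h := isLUB_around (x k) (Ici k) fun n => ⟨max n k, le_max_right n k, le_max_left n k⟩
      change IsLUB (range fun N : ℕ => if k ≤ N then (around (x k) N : IRBot) else ⊥) (iReal (x k))
      refine ⟨?_, fun b hb => h.2 ?_⟩
      · rintro _ ⟨N, rfl⟩
        by_cases hk : k ≤ N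
        · simp only [if_pos hk]
          exact h.1 ⟨N, hk, rfl⟩
        · simp [if_neg hk]
      · rintro _ ⟨N, hN, rfl⟩
        exact hb ⟨N, if_pos hN⟩
    · refine ⟨?_, fun _ _ => bot_le⟩
      rintro _ ⟨N, rfl⟩
      exact le_rfl

/-- The embedding `j` of the space of sequences of reals into `⟦int → real⟧`. -/
def jEmb : C(ℕ → ℝ, WithScott (Ty.arr Ty.int Ty.real).Den) where
  toFun x := WithScott.toScott (seqVal x)
  continuous_toFun := by
    refine continuous_of_approx (X := ScottHom (WithBot (Flat ℤ)) IRBot) fun x =>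
      ⟨seqApprox x, seqApprox_mono x, isLUB_seqApprox x, fun N => ?_⟩
    have h : ∀ᶠ y in nhds x, ∀ k ∈ Finset.range (N + 1), (around (x k) N : IRBot) ≤ iReal (y k) :=
      (Filter.eventually_all_finset _).2 fun k _ =>
        (continuous_apply k).continuousAt.eventually (around_le (x k) N)
    filter_upwards [h] with y hy n
    induction n using WithBot.recBotCoe with
    | bot => exact le_rfl
    | coe n =>
      obtain ⟨k | k⟩ := n
      · change (if k ≤ N then (around (x k) N : IRBot) else ⊥) ≤ iReal (y k)
        by_cases hk : k ≤ N
        · rw [if_pos hk]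
          exact hy k (by simpa using Nat.lt_succ_of_le hk)
        · rw [if_neg hk]
          exact bot_le
      · exact le_rfl

/-- The dcpo of partial bits, with elements `0`, `1` and `⊥`. -/
abbrev PBit : Type := WithBot (Flat Bool)

/-- The bit `b` as a partial bit. -/
def bitVal (b : Bool) : PBit := ((⟨b⟩ : Flat Bool) : WithBot (Flat Bool))

/-- The first bit of the binary expansion: `0` on `[a, b]` if `b < 1/2`, `1` if `a > 1/2`, and `⊥`
otherwise. -/
noncomputable def firstBit : IRBot → PBit :=
  strictExt fun a : IR =>
    if a.hi < 1 / 2 then bitVal false else if 1 / 2 < a.lo then bitVal true else ⊥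

/-- What remains after the first bit has been emitted: `[2a, 2b]` on `[a, b]` if `b < 1/2`,
`[2a - 1, 2b - 1]` if `a > 1/2`, and `⊥` otherwise. -/
noncomputable def restBits : IRBot → IRBot :=
  strictExt fun a : IR =>
    if a.hi < 1 / 2 then (IR.mk (2 * a.lo) (2 * a.hi) (by linarith [a.lo_le_hi]) : IR)
    else if 1 / 2 < a.lo then
      (IR.mk (2 * a.lo - 1) (2 * a.hi - 1) (by linarith [a.lo_le_hi]) : IR)
    else ⊥

/-- The partial binary expansion `bin'`. -/
noncomputable def binExp (a : IRBot) : ℕ → PBit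
  | 0 => firstBit a
  | k + 1 => binExp (restBits a) k

/-- The real number with a given binary expansion. -/
noncomputable def num (s : ℕ → Bool) : ℝ := ∑' k, (if s k then 1 else 0) / 2 ^ (k + 1)

/-- The term `do r ← sample [λ₁]; ret (mux r)`. -/
noncomputable def randUniformSeq {S : Signature} (hS : lam₁ ∈ S.measures)
    (mux : S.Const (.arr .real (.arr .int .real))) (r : ℕ) : Term S (.dist (.arr .int .real)) :=
  .bind .real r (.sample lam₁ hS) (.ret (.app (.const mux) (.var .real r)))

end ISPCF

namespace ISPCF

/-! The binary digits of a uniform random number are independent fair coin tosses, and infinitely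
many fair tosses can be dealt out into infinitely many independent sequences of tosses, each of
which is the expansion of a uniform number. The program does this, apart from a null set of samples
on which the partial expansion gets stuck.

The digits are read off the orbit of `x` under the doubling map. Each of its two branches carries
half of `[0, 1]` affinely onto `[0, 1]` up to an endpoint, so the leading digit is independent of
the rest of the orbit, which is again uniform (`leadBit_inter_doubling_eq_mul`). By induction the
digit sequence has the law of a product of coins (`map_bits`). As `num` inverts `bits` on `[0, 1]`,
it sends this product back to `lam₁` (`map_num`). A bijection of indices, currying, and `num`
applied to each row then give `map_split`: the map `split`, which redistributes the digits of one
number, pushes `lam₁` forward to `lam₁Inf`.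

On the semantic side, the body of the `do` is a Dirac valuation, so the integral is the `lam₁`-mass
of the set of `x` for which the value of `mux` at `i(x)` lies in the given open set
(`randUniformSeq_toFun`). The partial expansion of `i(x)` agrees with `bits x` unless the orbit of
`x` meets `1/2` (`binExp_iReal`), which happens for only countably many `x`. Hence for almost all
`x` this value is `seqVal (split pairing x)`, and changing the set on a null set does not change its
mass. -/

/-! ### Binary digits through the doubling map -/

/-- The leading binary digit of a number in `[0, 1]`. -/
noncomputable def leadBit (x : ℝ) : Bool := decide (1 / 2 ≤ x)

/-- The doubling map on `[0, 1]`. -/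
noncomputable def doubling (x : ℝ) : ℝ := if x < 1 / 2 then 2 * x else 2 * x - 1

/-- The binary digits of a number in `[0, 1]`. -/
noncomputable def bits (x : ℝ) (k : ℕ) : Bool := leadBit (doubling^[k] x)

theorem leadBit_eq_false {x : ℝ} : leadBit x = false ↔ x < 1 / 2 := by
  simp [leadBit]

theorem leadBit_eq_true {x : ℝ} : leadBit x = true ↔ 1 / 2 ≤ x := by
  simp [leadBit]

theorem measurable_leadBit : Measurable leadBit :=
  measurable_to_bool (by
    have : leadBit ⁻¹' {true} = Ici (1 / 2) := by ext x; simp [leadBit]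
    rw [this]
    exact measurableSet_Ici)

theorem measurable_doubling : Measurable doubling :=
  Measurable.ite measurableSet_Iio (by fun_prop) (by fun_prop)

theorem measurable_bits : Measurable bits :=
  measurable_pi_iff.2 fun k => measurable_leadBit.comp (measurable_doubling.iterate k)

/-! ### Binary expansions of reals -/

/-- The point `1` is fixed by the second branch, so it gets the expansion consisting of ones only
and the closed interval is invariant without an exceptional endpoint. -/
theorem doubling_mem {x : ℝ} (hx : x ∈ Icc (0 : ℝ) 1) : doubling x ∈ Icc (0 : ℝ) 1 := by
  obtain ⟨h0, h1⟩ := hx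
  unfold doubling
  split_ifs with h
  · constructor <;> linarith
  · constructor <;> linarith [not_lt.1 h]

theorem doubling_iterate_mem {x : ℝ} (hx : x ∈ Icc (0 : ℝ) 1) (n : ℕ) :
    doubling^[n] x ∈ Icc (0 : ℝ) 1 := by
  induction n with
  | zero => exact hx
  | succ n ih =>
    rw [Function.iterate_succ_apply']
    exact doubling_mem ih

/-- Read as `x = (digit + doubling x) / 2`, this is the recursion that makes the partial sums of the
expansion telescope. -/
theorem doubling_eq (x : ℝ) : doubling x = 2 * x - if leadBit x then 1 else 0 := by
  by_cases h : x < 1 / 2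
  · rw [doubling, if_pos h, leadBit_eq_false.2 h]
    simp
  · rw [doubling, if_neg h, leadBit_eq_true.2 (not_lt.1 h)]
    simp

/-- Iterating `x = (digit + doubling x) / 2` produces an exact remainder. The identity is algebraic
and needs no bound on `x`; the interval only matters for the size of the remainder. -/
theorem sum_bits (x : ℝ) (n : ℕ) :
    ∑ k ∈ Finset.range n, (if bits x k then (1 : ℝ) else 0) / 2 ^ (k + 1)
      = x - doubling^[n] x / 2 ^ n := by
  induction n with
  | zero => simp
  | succ n ih =>
    rw [Finset.sum_range_succ, ih, Function.iterate_succ_apply', doubling_eq]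
    change _ + (if leadBit (doubling^[n] x) then (1 : ℝ) else 0) / 2 ^ (n + 1) = _
    field_simp
    ring

/-- The orbit stays in `[0, 1]`, so the remainder after `n` digits lies between `0` and `2⁻ⁿ`.
Dyadic numbers need no exception, since `bits` chooses one expansion and only this composite is
claimed to be the identity. -/
theorem num_bits {x : ℝ} (hx : x ∈ Icc (0 : ℝ) 1) : num (bits x) = x := by
  refine HasSum.tsum_eq ((hasSum_iff_tendsto_nat_of_nonneg (fun k => ?_) x).2 ?_)
  · split_ifs <;> positivity
  · simp only [sum_bits]
    have h0 : Filter.Tendsto (fun n : ℕ => (1 / 2 : ℝ) ^ n) Filter.atTop (nhds 0) :=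
      tendsto_pow_atTop_nhds_zero_of_lt_one (by norm_num) (by norm_num)
    have h : Filter.Tendsto (fun n : ℕ => doubling^[n] x / 2 ^ n) Filter.atTop (nhds 0) := by
      refine squeeze_zero (fun n => ?_) (fun n => ?_) h0
      · exact div_nonneg (doubling_iterate_mem hx n).1 (by positivity)
      · rw [one_div_pow]
        gcongr
        exact (doubling_iterate_mem hx n).2
    simpa using h.const_sub x

/-- The series is dominated by a geometric one and each term depends on a single discrete
coordinate, so the sum is continuous for the product topology. -/
theorem measurable_num : Measurable num := by
  have : Continuous num := by
    refine continuous_tsum (u := fun k : ℕ => (1 / 2 : ℝ) ^ (k + 1)) (fun k => ?_) ?_ fun k s => ?_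
    · exact ((continuous_of_discreteTopology (f := fun b : Bool =>
        if b then (1 : ℝ) else 0)).comp (continuous_apply k)).div_const _
    · exact (summable_nat_add_iff 1).2 (summable_geometric_of_lt_one (by norm_num) (by norm_num))
    · rw [one_div_pow]
      split_ifs <;> simp
  exact this.measurable

/-! ### The digits of a uniform random number are independent -/

/-- On the half of `[0, 1]` where the digit is `c`, the doubling map is affine of slope `2` onto
`[0, 1]`, up to an endpoint. Lebesgue measure is therefore scaled by `1/2`, whatever `c` is. -/
theorem leadBit_inter_doubling (c : Bool) {A : Set ℝ} (hA : MeasurableSet A) :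
    lam₁ (leadBit ⁻¹' {c} ∩ doubling ⁻¹' A) = 2⁻¹ * lam₁ A := by
  have hm := (measurable_leadBit (measurableSet_singleton c)).inter (measurable_doubling hA)
  have h2 : ENNReal.ofReal |(2 : ℝ)⁻¹| = 2⁻¹ := by
    rw [abs_of_pos (by norm_num), ENNReal.ofReal_inv_of_pos (by norm_num)]
    simp
  rw [lam₁, Measure.restrict_apply hm, Measure.restrict_apply hA]
  cases c with
  | false =>
    have : leadBit ⁻¹' {false} ∩ doubling ⁻¹' A ∩ Icc 0 1
        = (fun x : ℝ => 2 * x) ⁻¹' (A ∩ Ico 0 1) := by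
      ext x
      simp only [mem_inter_iff, mem_preimage, mem_singleton_iff, leadBit_eq_false, mem_Icc, mem_Ico]
      constructor
      · rintro ⟨⟨h, hx⟩, h0, h1⟩
        rw [doubling, if_pos h] at hx
        exact ⟨hx, by linarith, by linarith⟩
      · rintro ⟨hx, h0, h1⟩
        have h : x < 1 / 2 := by linarith
        refine ⟨⟨h, ?_⟩, by linarith, by linarith⟩
        rwa [doubling, if_pos h]
    rw [this, Real.volume_preimage_mul_left two_ne_zero, h2]
    congr 1
    -- The lower half excludes `1/2`, so its image misses the point `1`, which is null.
    exact measure_congr (Filter.EventuallyEq.rfl.inter Ico_ae_eq_Icc)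
  | true =>
    -- The branch `2x - 1` is split into a scaling and a translation by `-1`, so that the scaling
    -- rule and translation invariance each apply.
    have : leadBit ⁻¹' {true} ∩ doubling ⁻¹' A ∩ Icc 0 1
        = (fun x : ℝ => 2 * x) ⁻¹' ((fun x => x + -1) ⁻¹' (A ∩ Icc 0 1)) := by
      ext x
      simp only [mem_inter_iff, mem_preimage, mem_singleton_iff, leadBit_eq_true, mem_Icc,
        ← sub_eq_add_neg]
      constructor
      · rintro ⟨⟨h, hx⟩, h0, h1⟩
        rw [doubling, if_neg (not_lt.2 h)] at hx
        exact ⟨hx, by linarith, by linarith⟩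
      · rintro ⟨hx, h0, h1⟩
        have h : 1 / 2 ≤ x := by linarith
        refine ⟨⟨h, ?_⟩, by linarith, by linarith⟩
        rwa [doubling, if_neg (not_lt.2 h)]
    rw [this, Real.volume_preimage_mul_left two_ne_zero, h2, measure_preimage_add_right]

/-- The distribution of the leading digit of a uniform random number. -/
noncomputable def coin : Measure Bool := lam₁.map leadBit

instance : IsProbabilityMeasure coin :=
  Measure.isProbabilityMeasure_map measurable_leadBit.aemeasurable

/-- Independence of the first digit from the remainder of the orbit, together with the fact that
this remainder is uniform again. -/
theorem leadBit_inter_doubling_eq_mul (t : Set Bool) {A : Set ℝ} (hA : MeasurableSet A) :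
    lam₁ (leadBit ⁻¹' t ∩ doubling ⁻¹' A) = coin t * lam₁ A := by
  -- For fixed `A` both sides of the claim are measures in `t` on a two-point space, so it suffices
  -- to compare them on singletons.
  have h : (lam₁.restrict (doubling ⁻¹' A)).map leadBit = lam₁ A • coin := by
    refine Measure.ext_of_singleton fun c => ?_
    have hc := measurableSet_singleton c
    -- Taking `A` to be everything shows that `coin` gives mass `1/2` to each digit.
    have h1 := leadBit_inter_doubling c MeasurableSet.univ
    rw [preimage_univ, inter_univ, measure_univ, mul_one] at h1
    rw [Measure.map_apply measurable_leadBit hc, Measure.restrict_apply (measurable_leadBit hc),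
      leadBit_inter_doubling c hA, Measure.smul_apply, coin, Measure.map_apply measurable_leadBit hc,
      h1, smul_eq_mul, mul_comm]
  have ht : MeasurableSet t := t.toFinite.measurableSet
  have := congrArg (fun μ : Measure Bool => μ t) h
  simpa only [Measure.map_apply measurable_leadBit ht,
    Measure.restrict_apply (measurable_leadBit ht), Measure.smul_apply, smul_eq_mul,
    mul_comm (lam₁ A)] using this

theorem bits_succ (x : ℝ) (k : ℕ) : bits x (k + 1) = bits (doubling x) k := rfl

/-- The later digits of `x` are the digits of `doubling x`, so independence peels off one factor at
a time. The family `t` varies in the induction because it is shifted by one at each step. -/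
theorem lam₁_bits_range (n : ℕ) (t : ℕ → Set Bool) :
    lam₁ {x | ∀ k < n, bits x k ∈ t k} = ∏ k ∈ Finset.range n, coin (t k) := by
  induction n generalizing t with
  | zero => simp
  | succ n ih =>
    have : {x | ∀ k < n + 1, bits x k ∈ t k}
        = leadBit ⁻¹' t 0 ∩ doubling ⁻¹' {x | ∀ k < n, bits x k ∈ t (k + 1)} := by
      ext x
      simp only [mem_ofPred_eq, mem_inter_iff, mem_preimage, ← bits_succ]
      constructor
      · exact fun h => ⟨h 0 (Nat.succ_pos n), fun k hk => h _ (Nat.succ_lt_succ hk)⟩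
      · rintro ⟨h0, h⟩ (_ | k) hk
        · exact h0
        · exact h k (Nat.lt_of_succ_lt_succ hk)
    have hm : MeasurableSet {x | ∀ k < n, bits x k ∈ t (k + 1)} := by
      simp only [ofPred_forall]
      exact .iInter fun k => .iInter fun _ =>
        (measurable_pi_iff.1 measurable_bits k) (toFinite _).measurableSet
    rw [this, leadBit_inter_doubling_eq_mul _ hm, ih, Finset.prod_range_succ', mul_comm]

/-- An infinite product measure is determined by its values on boxes with finitely many constrained
coordinates. -/
theorem map_bits : lam₁.map bits = Measure.infinitePi fun _ : ℕ => coin := by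
  classical
  refine Measure.eq_infinitePi _ fun s t ht => ?_
  rw [Measure.map_apply measurable_bits (.pi s.countable_toSet fun k _ => ht k)]
  obtain ⟨n, hn⟩ := s.exists_nat_subset_range
  -- The finite index set `s` is enlarged to an initial segment; the added coordinates are left
  -- unconstrained and contribute factors equal to `1`.
  have h := lam₁_bits_range n fun k => if k ∈ s then t k else univ
  have e : bits ⁻¹' (s : Set ℕ).pi t
      = {x | ∀ k < n, bits x k ∈ if k ∈ s then t k else univ} := by
    ext x
    simp only [mem_preimage, Set.mem_pi, Finset.mem_coe, mem_ofPred_eq]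
    constructor
    · intro hx k _
      split_ifs with hk
      · exact hx k hk
      · trivial
    · intro hx k hk
      simpa [hk] using hx k (Finset.mem_range.1 (hn hk))
  rw [e, h, ← Finset.prod_subset hn fun k _ hk => by rw [if_neg hk, measure_univ]]
  exact Finset.prod_congr rfl fun k hk => by simp [hk]

/-- Since `bits` carries `lam₁` to the product of coins and `num` undoes `bits` on `[0, 1]`, which
has full measure, `num` carries the product back. -/
theorem map_num : (Measure.infinitePi fun _ : ℕ => coin).map num = lam₁ := by
  rw [← map_bits, Measure.map_map measurable_num measurable_bits]
  have h : num ∘ bits =ᵐ[lam₁] id :=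
    (ae_restrict_iff' measurableSet_Icc).2 (ae_of_all _ fun x hx => num_bits hx)
  rw [Measure.map_congr h, Measure.map_id]

/-! ### Splitting the digits into countably many sequences -/

/-- The sequence of reals whose digits are obtained by splitting those of `x`. -/
noncomputable def split (pairing : ℕ × ℕ ≃ ℕ) (x : ℝ) (m : ℕ) : ℝ :=
  num fun n => bits x (pairing (m, n))

theorem measurable_split (pairing : ℕ × ℕ ≃ ℕ) : Measurable (split pairing) :=
  measurable_pi_iff.2 fun _ => measurable_num.comp
    (measurable_pi_iff.2 fun _ => measurable_pi_iff.1 measurable_bits _)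

/-- Reindexing by a bijection preserves a product of identical coins, currying turns it into a
product of rows, the rows are thus independent, and `num` makes each of them uniform. -/
theorem map_split (pairing : ℕ × ℕ ≃ ℕ) : lam₁.map (split pairing) = lam₁Inf := by
  have h1 : (Measure.infinitePi fun _ : ℕ => coin).map (fun s (p : ℕ × ℕ) => s (pairing p))
      = Measure.infinitePi fun _ : ℕ × ℕ => coin := by
    have h := Measure.infinitePi_map_piCongrLeft (X := fun _ : ℕ × ℕ => Bool) (fun _ => coin)
      pairing.symm
    rw [← h]
    congr 1
    funext s p
    -- The evaluation rule concerns the image of an index under `pairing.symm`; the index `pairing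
    -- p` has image `p`.
    have h' := Equiv.piCongrLeft_apply_apply (fun _ : ℕ × ℕ => Bool) pairing.symm s (pairing p)
    rw [pairing.symm_apply_apply] at h'
    exact h'.symm
  have h2 := Measure.infinitePi_map_curry (fun _ _ : ℕ => coin)
  have h3 := Measure.infinitePi_map_pi (ι := ℕ) (fun _ => Measure.infinitePi fun _ : ℕ => coin)
    (f := fun _ => num) fun _ => measurable_num
  have m1 : Measurable fun (s : ℕ → Bool) (p : ℕ × ℕ) => s (pairing p) := by fun_prop
  have m3 : Measurable fun (s : ℕ → ℕ → Bool) m => num (s m) :=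
    measurable_pi_iff.2 fun m => measurable_num.comp (measurable_pi_apply m)
  -- The right-hand side of `h3` becomes a product of copies of `lam₁`, that is, `lam₁Inf`. The
  -- rewriting below then traces its source back to `lam₁` through `bits`, reindexing and currying.
  simp only [map_num] at h3
  have m2 := (MeasurableEquiv.curry ℕ ℕ Bool).measurable.comp m1
  rw [← h2, ← h1, ← map_bits, Measure.map_map (MeasurableEquiv.measurable _) m1,
    Measure.map_map m3 m2, Measure.map_map (m3.comp m2) measurable_bits] at h3
  exact h3

/-! ### The partial binary expansion of a real -/

theorem firstBit_iReal {x : ℝ} (hx : x ≠ 1 / 2) : firstBit (iReal x) = bitVal (leadBit x) := by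
  change (if x < 1 / 2 then bitVal false else if 1 / 2 < x then bitVal true else ⊥) = _
  rcases hx.lt_or_gt with h | h
  · rw [if_pos h, leadBit_eq_false.2 h]
  · rw [if_neg h.not_gt, if_pos h, leadBit_eq_true.2 h.le]

theorem restBits_iReal {x : ℝ} (hx : x ≠ 1 / 2) : restBits (iReal x) = iReal (doubling x) := by
  change (if x < 1 / 2 then iReal (2 * x) else if 1 / 2 < x then iReal (2 * x - 1) else ⊥) = _
  rcases hx.lt_or_gt with h | h
  · rw [if_pos h, doubling, if_pos h]
  · rw [if_neg h.not_gt, if_pos h, doubling, if_neg h.not_gt]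

/-- At `1/2` neither strict inequality holds, so the partial expansion emits `⊥` and remains
undefined from then on. As long as the orbit avoids `1/2`, the strict tests agree with those that
define `leadBit` and `doubling`. -/
theorem binExp_iReal {x : ℝ} (hx : ∀ k, doubling^[k] x ≠ 1 / 2) (k : ℕ) :
    binExp (iReal x) k = bitVal (bits x k) := by
  induction k generalizing x with
  | zero => exact firstBit_iReal (hx 0)
  | succ k ih =>
    rw [binExp, restBits_iReal (x := x) (hx 0), ih fun j => hx (j + 1), bits_succ]

/-- A point `y` has at most two preimages, `y / 2` and `(y + 1) / 2`, one for each branch. -/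
theorem countable_doubling_preimage {A : Set ℝ} (hA : A.Countable) :
    (doubling ⁻¹' A).Countable := by
  refine ((hA.image fun y => y / 2).union (hA.image fun y => (y + 1) / 2)).mono fun x hx => ?_
  by_cases h : x < 1 / 2
  · exact .inl ⟨_, hx, by rw [doubling, if_pos h]; ring⟩
  · exact .inr ⟨_, hx, by rw [doubling, if_neg h]; ring⟩

/-- The points whose orbit meets `y` form a countable union of countable sets, hence a null set. -/
theorem ae_doubling_iterate_ne (y : ℝ) : ∀ᵐ x ∂lam₁, ∀ k, doubling^[k] x ≠ y := by
  refine ae_restrict_of_ae (ae_all_iff.2 fun k => ?_)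
  have : (doubling^[k] ⁻¹' {y}).Countable := by
    induction k with
    | zero => simp
    | succ k ih =>
      rw [Function.iterate_succ, preimage_comp]
      exact countable_doubling_preimage ih
  exact this.ae_notMem volume

/-! ### The semantics of the sampler -/

section Scott

open ContVal

variable {X Y : Type} [PartialOrder X] [PartialOrder Y]

/-- The inverse image of a Scott-open set under a Scott-continuous map. -/
def scottComap (g : ScottHom X Y) (V : Opens (WithScott Y)) : Opens (WithScott X) where
  carrier := {x | WithScott.toScott (g.1 (WithScott.ofScott x)) ∈ V}
  is_open' := by
    refine isOpen_scott_iff.2 ⟨fun x y h hx => ?_, ?_⟩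
    · have h' : g.1 (WithScott.ofScott x) ≤ g.1 (WithScott.ofScott y) := g.2.monotone h
      exact isUpperSet_opens V h' hx
    · intro d hne hd a ha hV
      obtain ⟨_, ⟨x, hx, rfl⟩, hxV⟩ := (isOpen_scott_iff.1 V.isOpen).2 (hne.image g.1)
        (directedOn_image_mono (X := X) (Y := Y) hd g.2.monotone) (g.2 hne hd ha) hV
      exact ⟨x, hx, hxV⟩

/-- Integrating a family of Dirac valuations yields the mass of an inverse image. -/
theorem bindAux_dirac (f : ScottHom X (MinVal Y)) (g : ScottHom X Y)
    (hf : ∀ x, f.1 x = MinVal.dirac (g.1 x)) (μ : ContVal (WithScott X))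
    (V : Opens (WithScott Y)) : bindAux f μ V = μ.toFun (scottComap g V) := by
  have hval : ∀ x : WithScott X, (f.1 (WithScott.ofScott x)).1.toFun V
      = (scottComap g V : Set (WithScott X)).indicator 1 x := fun x => by
    rw [hf]
    rfl
  -- The integrand is the indicator of `scottComap g V`. Its superlevel set at height `t` is that
  -- open set if `t < 1` and is empty otherwise, so Choquet's formula integrates a constant over
  -- `(0, 1)`.
  have key : ∀ t ∈ Ioi (0 : ℝ), μ.toFun (superlevel
      (fun x => (f.1 (WithScott.ofScott x)).1.toFun V)
      (lowerSemicontinuous_of_scott (ScottContinuous.comp f.2 (MinVal.scott_apply V))) t)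
      = {t : ℝ | ENNReal.ofReal t < 1}.indicator 1 t * μ.toFun (scottComap g V) := by
    intro t _
    by_cases ht : ENNReal.ofReal t < 1
    · rw [indicator_of_mem (show t ∈ {t : ℝ | ENNReal.ofReal t < 1} from ht), Pi.one_apply, one_mul]
      congr 1
      ext x
      change ENNReal.ofReal t < (f.1 (WithScott.ofScott x)).1.toFun V ↔ x ∈ scottComap g V
      rw [hval]
      by_cases hx : x ∈ scottComap g V <;> simp [indicator, hx, ht]
    · rw [indicator_of_notMem (show t ∉ {t : ℝ | ENNReal.ofReal t < 1} from ht), zero_mul,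
        ← μ.map_bot]
      congr 1
      ext x
      change ENNReal.ofReal t < (f.1 (WithScott.ofScott x)).1.toFun V ↔ False
      rw [hval, iff_false, not_lt]
      exact (indicator_le_self' (fun _ _ => zero_le) x).trans (not_lt.1 ht)
  rw [bindAux, ContVal.integral, setLIntegral_congr_fun measurableSet_Ioi key, lintegral_mul_const,
    lintegral_lt, one_mul]
  exact measurable_one.indicator (ENNReal.measurable_ofReal measurableSet_Iio)

end Scott

/-- The body of the `do` is a Dirac valuation at the value of `mux`, so the program denotes the
image of `i[λ₁]` under the semantics of `mux`; unfolding the image under `i` leaves a set of real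
samples. -/
theorem randUniformSeq_toFun {S : Signature} (hS : lam₁ ∈ S.measures)
    (mux : S.Const (.arr .real (.arr .int .real))) (r : ℕ) (ρ : Env)
    (V : Opens (WithScott (Ty.arr .int .real).Den)) :
    ((randUniformSeq hS mux r).eval ρ).val.toFun V
      = lam₁ {x | WithScott.toScott ((S.den mux).app (realVal x)) ∈ V} := by
  refine bindAux_dirac (X := IRBot) (Y := ScottHom (WithBot (Flat ℤ)) IRBot) _ (S.den mux)
    (fun a => ?_) (Sem.sample lam₁).1 V
  -- The body is evaluated in the updated environment, where the bound variable has value `a`.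
  change MinVal.dirac ((S.den mux).app (ρ.set .real r a (.real, r))) = _
  have h : ρ.set .real r a (.real, r) = a := Function.update_self ..
  rw [h]
  rfl

/-- An element of `⟦int → real⟧` is determined by its values at the integers and at `⊥`. -/
theorem eq_seqVal {f : (Ty.arr .int .real).Den} {x : ℕ → ℝ}
    (h : ∀ m : ℕ, f.app (intVal m) = iReal (x m))
    (hbot : ∀ k : Ty.int.Den, (∀ m : ℕ, k ≠ intVal m) → f.app k = ⊥) : f = seqVal x := by
  refine Subtype.ext (funext fun k => ?_)
  change f.app k = _
  induction k using WithBot.recBotCoe with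
  | bot => exact hbot ⊥ fun m => WithBot.bot_ne_coe
  | coe k =>
    obtain ⟨m | m⟩ := k
    · exact h m
    -- At a negative integer `seqVal x` is `⊥` by definition; what is left is that such an integer
    -- is not the image of a natural number.
    · refine hbot _ fun n hn => ?_
      have := congrArg Flat.val (WithBot.coe_injective hn)
      simp at this

end ISPCF

/-! ### The law of the sampled sequence -/

theorem mainTheorem10 (S : ISPCF.Signature) (hS : ISPCF.lam₁ ∈ S.measures)
    (pairing : ℕ × ℕ ≃ ℕ)
    (num' : ISPCF.ScottHom (ℕ → ISPCF.PBit) ISPCF.IRBot)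
    (hnum' : ∀ s : ℕ → Bool, num'.1 (fun k => ISPCF.bitVal (s k)) = ISPCF.iReal (ISPCF.num s))
    (mux : S.Const (.arr .real (.arr .int .real)))
    (hmux : ∀ (x : ℝ) (m : ℕ),
      ((S.den mux).app (ISPCF.realVal x)).app (ISPCF.intVal m) =
        num'.1 (fun n => ISPCF.binExp (ISPCF.iReal x) (pairing (m, n))))
    (hmux_bot : ∀ (x : ℝ) (k : ISPCF.Ty.int.Den), (∀ m : ℕ, k ≠ ISPCF.intVal m) →
      ((S.den mux).app (ISPCF.realVal x)).app k = ⊥)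
    (r : ℕ) (ρ : ISPCF.Env) :
    ((ISPCF.randUniformSeq hS mux r).eval ρ).val =
      (ISPCF.ContVal.ofMeasure ISPCF.lam₁Inf).map ISPCF.jEmb := by
  refine ISPCF.ContVal.ext' fun V => ?_
  rw [ISPCF.randUniformSeq_toFun]
  -- For almost every `x` all digits are defined. This is what makes `hnum'` applicable, since it
  -- describes `num'` on total sequences of bits only.
  have hmux_eq : ∀ᵐ x ∂ISPCF.lam₁,
      (S.den mux).app (ISPCF.realVal x) = ISPCF.seqVal (ISPCF.split pairing x) := by
    filter_upwards [ISPCF.ae_doubling_iterate_ne (1 / 2)] with x hx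
    refine ISPCF.eq_seqVal (fun m => ?_) (hmux_bot x)
    rw [hmux]
    simp only [ISPCF.binExp_iReal hx]
    exact hnum' _
  let A : Set (ℕ → ℝ) := Opens.comap ISPCF.jEmb V
  have hA : MeasurableSet A := (Opens.comap ISPCF.jEmb V).isOpen.measurableSet
  change _ = ISPCF.lam₁Inf A
  rw [← ISPCF.map_split pairing, Measure.map_apply (ISPCF.measurable_split pairing) hA]
  -- Both sides are now `lam₁`-masses of sets of samples, and these sets differ only where `mux` and
  -- `split` disagree.
  refine measure_congr ?_
  filter_upwards [hmux_eq] with x hx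
  refine propext ?_
  change WithScott.toScott ((S.den mux).app (ISPCF.realVal x)) ∈ V ↔
    WithScott.toScott (ISPCF.seqVal (ISPCF.split pairing x)) ∈ V
  rw [hx]
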